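/- Let $k$ be an algebraically closed field of characteristic $p>3$ and let $n\ge 2$. Let $\mathcal O(1;n)$ be the divided power algebra with $k$-basis $x^{(a)}$, $0\le a\le p^n-1$, and product $x^{(a)}x^{(b)}=\binom{a+b}{a}x^{(a+b)}$ if $a+b\le p^n-1$ and $0$ otherwise; write $x=x^{(1)}$. Let $\mathfrak m$ be its maximal ideal, spanned by the $x^{(a)}$ with $a\ge 1$. Elements $f\in\mathfrak m$ have divided powers $f^{(r)}$, $r\ge 0$, computed in the full divided power algebra $\mathcal O(1)\supset\mathcal O(1;n)$ with basis $x^{(a)}$, $a\ge 0$. Let $G$ be the group of admissible automorphisms of $\mathcal O(1;n)$, i.e. the $k$-algebra automorphisms $\Phi$ with $\Phi(f^{(r)})=\Phi(f)^{(r)}$ for all $f\in\mathfrak m$, $r\ge 0$ (in the sense that $f^{(r)}\in\mathcal O(1;n)$ if and only if $\Phi(f)^{(r)}\in\mathcal O(1;n)$, and then the equation holds). Let $\mathfrak L=W(1;n)$ be the Zassenhaus algebra, i.e. the Lie algebra of all derivations $\mathcal D$ of $\mathcal O(1;n)$ with $\mathcal D(x^{(a)})=x^{(a-1)}\mathcal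 D(x)$ for $1\le a\le p^n-1$. Let $\partial\in\mathfrak L$ be the derivation with $\partial(x^{(a)})=x^{(a-1)}$ for $1\le a\le p^n-1$ and $\partial(1)=0$, and let $\mathfrak L_{(0)}\subset\mathfrak L$ be the span of the $x^{(a)}\partial$ with $1\le a\le p^n-1$. Let $\mathfrak L_p$ be the minimal $p$-envelope of $\mathfrak L$, i.e. the $p$-envelope of $\mathfrak L\cong\operatorname{ad}\mathfrak L$ in $\operatorname{Der}(\mathfrak L)$, with $\mathfrak L$ identified with $\operatorname{ad}\mathfrak L$, and let $\mathcal N$ be the set of nilpotent elements of $\mathfrak L_p$. The group $G$ acts on $\mathfrak L$ by $\mathcal D\mapsto\Phi\mathcal D\Phi^{-1}$, and hence on $\operatorname{Der}(\mathfrak L)$ and on $\mathfrak L_p$. Put $$\mathcal N_{\mathrm{reg}}:=\{\mathcal D\in\mathcal N : \mathcal D^{p^{n-1}}\notin\mathfrak L_{(0)}\}.$$ Then $$\mathcal N_{\mathrm{reg}}=G.\bigl(k^{*}\partial+k\partial^{p}+\dots+k\partial^{p^{n-1}}\bigr).$$ Moreover, an element $\mathcal D\in\operatorname{End}_k(\mathfrak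 L)$ belongs to $\mathcal N_{\mathrm{reg}}$ if and only if it is conjugate under $G$ to $\partial^{p^t}+\sum_{i=0}^{t-1}\gamma_i\partial^{p^i}$ for some $0\le t\le n-1$ and $\gamma_i\in k$, where $\gamma_0\ne 0$ if $t\ge 1$ (for $t=0$ the element is $\partial$). -/

import Mathlib

namespace Zassenhaus

open Finset

universe u

/-- Formal divided power series `∑ f a • x^(a)` in one variable, given by the sequence of the
coefficients `f a`. -/
structure DPSeries (k : Type u) : Type u where
  /-- The coefficients. -/
  coeff : ℕ → k

namespace DPSeries

variable {k : Type u}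

theorem coeff_injective : Function.Injective (coeff : DPSeries k → ℕ → k) :=
  fun ⟨_⟩ ⟨_⟩ h => congrArg DPSeries.mk h

instance : FunLike (DPSeries k) ℕ k := ⟨coeff, coeff_injective⟩

@[ext] theorem ext {f g : DPSeries k} (h : ∀ a, f a = g a) : f = g := DFunLike.ext f g h

variable [Field k]

instance : Zero (DPSeries k) := ⟨⟨0⟩⟩

instance : Add (DPSeries k) := ⟨fun f g => ⟨fun a => f a + g a⟩⟩

instance : Neg (DPSeries k) := ⟨fun f => ⟨fun a => -f a⟩⟩

instance : Sub (DPSeries k) := ⟨fun f g => ⟨fun a => f a - g a⟩⟩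

instance {R : Type*} [SMul R k] : SMul R (DPSeries k) := ⟨fun r f => ⟨fun a => r • f a⟩⟩

instance : AddCommGroup (DPSeries k) :=
  coeff_injective.addCommGroup _ rfl (fun _ _ => rfl) (fun _ => rfl) (fun _ _ => rfl)
    (fun _ _ => rfl) (fun _ _ => rfl)

instance : Module k (DPSeries k) :=
  coeff_injective.module k ⟨⟨coeff, rfl⟩, fun _ _ => rfl⟩ (fun _ _ => rfl)

/-- The product, determined by `x^(a) * x^(b) = (a + b).choose a • x^(a + b)`. -/
instance : Mul (DPSeries k) :=
  ⟨fun f g => ⟨fun c => ∑ ab ∈ antidiagonal c, (c.choose ab.1 : k) * (f ab.1 * g ab.2)⟩⟩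

/-- The basis element `x^(a)`. -/
def x (a : ℕ) : DPSeries k := ⟨fun b => if b = a then 1 else 0⟩

instance : One (DPSeries k) := ⟨x 0⟩

@[simp] theorem add_apply (f g : DPSeries k) (c : ℕ) : (f + g) c = f c + g c := rfl

@[simp] theorem zero_apply (c : ℕ) : (0 : DPSeries k) c = 0 := rfl

@[simp] theorem smul_apply (r : k) (f : DPSeries k) (c : ℕ) : (r • f) c = r * f c := rfl

theorem one_apply (c : ℕ) : (1 : DPSeries k) c = if c = 0 then 1 else 0 := rfl

theorem x_apply (a c : ℕ) : (x a : DPSeries k) c = if c = a then 1 else 0 := rfl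

theorem mul_apply (f g : DPSeries k) (c : ℕ) :
    (f * g) c = ∑ ab ∈ antidiagonal c, (c.choose ab.1 : k) * (f ab.1 * g ab.2) := rfl

@[simp] theorem mul_apply_zero (f g : DPSeries k) : (f * g) 0 = f 0 * g 0 := by
  simp [mul_apply]

/-- The derivative, `x^(a + 1) ↦ x^(a)` and `1 ↦ 0`. -/
def deriv : DPSeries k →ₗ[k] DPSeries k where
  toFun f := ⟨fun a => f (a + 1)⟩
  map_add' _ _ := rfl
  map_smul' _ _ := rfl

/-- The antiderivative without constant term, `x^(a) ↦ x^(a + 1)`. -/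
def integ (f : DPSeries k) : DPSeries k := ⟨fun a => Nat.casesOn a 0 f⟩

@[simp] theorem deriv_apply (f : DPSeries k) (a : ℕ) : deriv f a = f (a + 1) := rfl

@[simp] theorem integ_zero (f : DPSeries k) : integ f 0 = 0 := rfl

@[simp] theorem deriv_integ (f : DPSeries k) : deriv (integ f) = f := rfl

theorem eq_of_deriv {f g : DPSeries k} (h0 : f 0 = g 0) (h : deriv f = deriv g) : f = g := by
  ext a
  cases a with
  | zero => exact h0
  | succ a => exact DFunLike.congr_fun h a

theorem mul_comm' (f g : DPSeries k) : f * g = g * f := by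
  ext c
  rw [mul_apply, mul_apply, ← Finset.sum_equiv (Equiv.prodComm ℕ ℕ)
    (s := antidiagonal c) (g := fun ab => (c.choose ab.1 : k) * (g ab.1 * f ab.2))]
  · intro i; simp [add_comm]
  · rintro ⟨a, b⟩ h
    have h' : a + b = c := by simpa using h
    have : c.choose a = c.choose b := Nat.choose_symm_of_eq_add (by omega)
    simp only [Equiv.prodComm_apply, Prod.swap_prod_mk, this]
    ring

theorem deriv_mul (f g : DPSeries k) : deriv (f * g) = deriv f * g + f * deriv g := by
  ext c
  have h := sum_antidiagonal_choose_succ_mul (R := k) (fun a b => f a * g b) c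
  simp only [deriv_apply, add_apply, mul_apply]
  rw [h, add_comm]
  congr 1
  refine Finset.sum_congr rfl ?_
  rintro ⟨a, b⟩ h
  have h' : a + b = c := by simpa using h
  have : c.choose a = c.choose b := Nat.choose_symm_of_eq_add (by omega)
  simp [this]

theorem add_mul' (f g h : DPSeries k) : (f + g) * h = f * h + g * h := by
  ext c
  simp only [mul_apply, add_apply, ← Finset.sum_add_distrib]
  exact Finset.sum_congr rfl fun _ _ => by ring

theorem one_mul' (f : DPSeries k) : 1 * f = f := by
  have h1 : deriv (1 : DPSeries k) = 0 := by ext a; simp [one_apply]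
  have h0 : ∀ g : DPSeries k, 0 * g = 0 := fun g => by ext c; simp [mul_apply]
  have key : ∀ (c : ℕ) (f : DPSeries k), (1 * f) c = f c := by
    intro c
    induction c with
    | zero => intro f; simp [one_apply]
    | succ c ih =>
      intro f
      rw [← deriv_apply, deriv_mul, h1, h0, zero_add, ih, deriv_apply]
  exact ext fun c => key c f

theorem mul_assoc' (f g h : DPSeries k) : f * g * h = f * (g * h) := by
  have key : ∀ (c : ℕ) (f g h : DPSeries k), (f * g * h) c = (f * (g * h)) c := by
    intro c
    induction c with
    | zero => intro f g h; simp [mul_assoc]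
    | succ c ih =>
      intro f g h
      have h2 : ∀ u v w : DPSeries k, u * (v + w) = u * v + u * w := fun u v w => by
        rw [mul_comm', add_mul', mul_comm' v, mul_comm' w]
      rw [← deriv_apply, ← deriv_apply]
      simp only [deriv_mul, add_mul', h2, add_apply, ih]
      ring
  exact ext fun c => key c f g h

instance : CommRing (DPSeries k) :=
  { (inferInstance : AddCommGroup (DPSeries k)) with
    mul := (· * ·)
    one := 1
    mul_assoc := mul_assoc'
    one_mul := one_mul'
    mul_one := fun f => by rw [mul_comm']; exact one_mul' f
    mul_comm := mul_comm'
    left_distrib := fun f g h => by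
      rw [mul_comm', add_mul', mul_comm' g, mul_comm' h]
    right_distrib := add_mul'
    zero_mul := fun g => by ext c; simp [mul_apply]
    mul_zero := fun g => by ext c; simp [mul_apply] }

instance : Algebra k (DPSeries k) :=
  Algebra.ofModule
    (fun r f g => by
      ext c; simp only [mul_apply, smul_apply, Finset.mul_sum]
      exact Finset.sum_congr rfl fun _ _ => by ring)
    (fun r f g => by
      ext c; simp only [mul_apply, smul_apply, Finset.mul_sum]
      exact Finset.sum_congr rfl fun _ _ => by ring)

/-- The ideal of the series without constant term. -/
def maxIdeal (k : Type u) [Field k] : Ideal (DPSeries k) where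
  carrier := {f | f 0 = 0}
  add_mem' := fun {f g} hf hg => by
    have hf' : f 0 = 0 := hf
    have hg' : g 0 = 0 := hg
    simp [hf', hg']
  zero_mem' := rfl
  smul_mem' := fun r f hf => by
    have hf' : f 0 = 0 := hf
    simp [hf']

theorem mem_maxIdeal {f : DPSeries k} : f ∈ maxIdeal k ↔ f 0 = 0 := Iff.rfl

/-- `dpowAux f r` is `f^(r)` for `f` without constant term: `f^(0) = 1`, and `f^(r + 1)` is
the series without constant term whose derivative is `f^(r) * f'`. -/
def dpowAux (f : DPSeries k) : ℕ → DPSeries k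
  | 0 => 1
  | r + 1 => integ (dpowAux f r * deriv f)

@[simp] theorem dpowAux_zero (f : DPSeries k) : dpowAux f 0 = 1 := rfl

@[simp] theorem dpowAux_succ_apply_zero (f : DPSeries k) (r : ℕ) : dpowAux f (r + 1) 0 = 0 := rfl

@[simp] theorem deriv_dpowAux (f : DPSeries k) (r : ℕ) :
    deriv (dpowAux f (r + 1)) = dpowAux f r * deriv f := rfl

@[simp] theorem deriv_one : deriv (1 : DPSeries k) = 0 := by ext a; simp [one_apply]

@[simp] theorem deriv_natCast (m : ℕ) : deriv (m : DPSeries k) = 0 := by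
  rw [← nsmul_one, map_nsmul, deriv_one, smul_zero]

theorem dpowAux_one {f : DPSeries k} (hf : f 0 = 0) : dpowAux f 1 = f :=
  eq_of_deriv (by simp [hf]) (by rw [deriv_dpowAux, dpowAux_zero, one_mul])

theorem mul_dpowAux (f : DPSeries k) (m n : ℕ) :
    dpowAux f m * dpowAux f n = ((m + n).choose m : ℕ) * dpowAux f (m + n) := by
  obtain ⟨s, hs⟩ : ∃ s, s = m + n := ⟨_, rfl⟩
  induction s generalizing m n with
  | zero =>
    obtain ⟨rfl, rfl⟩ : m = 0 ∧ n = 0 := by omega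
    simp
  | succ s ih =>
    rcases m with _ | m
    · simp
    rcases n with _ | n
    · simp
    refine eq_of_deriv (by simp [← add_assoc]) ?_
    have e1 := ih (m + 1) n (by omega)
    have e2 := ih m (n + 1) (by omega)
    have h1 : m + 1 + n = m + n + 1 := by ring
    have h2 : m + (n + 1) = m + n + 1 := by ring
    have h3 : m + 1 + (n + 1) = m + n + 1 + 1 := by ring
    rw [h1] at e1
    rw [h2] at e2
    rw [h3, Nat.choose_succ_succ]
    rw [deriv_mul, deriv_mul, deriv_natCast]
    simp only [deriv_dpowAux, zero_mul, zero_add, Nat.cast_add]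
    linear_combination (deriv f) * e1 + (deriv f) * e2

theorem dpowAux_add {f g : DPSeries k} (n : ℕ) :
    dpowAux (f + g) n = ∑ ij ∈ antidiagonal n, dpowAux f ij.1 * dpowAux g ij.2 := by
  induction n with
  | zero => simp
  | succ n ih =>
    refine eq_of_deriv ?_ ?_
    · rw [Finset.Nat.sum_antidiagonal_succ]
      have : ∀ (ι : Type) (s : Finset ι) (F : ι → DPSeries k),
          (∑ i ∈ s, F i) 0 = ∑ i ∈ s, F i 0 := fun ι s F => by
        classical
        induction s using Finset.induction_on with
        | empty => simp
        | insert a s ha h => rw [Finset.sum_insert ha, Finset.sum_insert ha, add_apply, h]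
      simp [this]
    · rw [deriv_dpowAux, ih, map_sum]
      simp only [deriv_mul, Finset.sum_add_distrib]
      rw [Finset.Nat.sum_antidiagonal_succ, Finset.Nat.sum_antidiagonal_succ' (n := n)]
      simp only [dpowAux_zero, deriv_one, zero_mul, mul_zero, zero_add, deriv_dpowAux,
        map_add, mul_add, Finset.sum_mul]
      congr 1 <;> refine Finset.sum_congr rfl fun _ _ => by ring

theorem dpowAux_mul {a f : DPSeries k} (hf : f 0 = 0) (n : ℕ) :
    dpowAux (a * f) n = a ^ n * dpowAux f n := by
  have hpow : ∀ m : ℕ, deriv (a ^ m) = m * a ^ (m - 1) * deriv a := fun m => by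
    induction m with
    | zero => simp
    | succ m ih =>
      rw [pow_succ, deriv_mul, ih]
      rcases m with _ | m
      · simp
      · simp only [Nat.add_sub_cancel]; push_cast; ring
  induction n with
  | zero => simp
  | succ n ih =>
    refine eq_of_deriv (by simp) ?_
    have h := mul_dpowAux f 1 n
    rw [dpowAux_one hf, add_comm 1 n, Nat.choose_one_right] at h
    rw [deriv_dpowAux, ih, deriv_mul, deriv_mul, hpow, deriv_dpowAux, Nat.add_sub_cancel]
    linear_combination (a ^ n * deriv a) * h

theorem dpowAux_comp (f : DPSeries k) (m : ℕ) {n : ℕ} (hn : n ≠ 0) :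
    dpowAux (dpowAux f n) m = (m.uniformBell n : ℕ) * dpowAux f (m * n) := by
  obtain ⟨n, rfl⟩ := Nat.exists_eq_succ_of_ne_zero hn
  simp only [Nat.succ_eq_add_one] at hn ⊢
  induction m with
  | zero => simp [Nat.uniformBell_zero_left]
  | succ m ih =>
    have e : (m + 1) * (n + 1) = (m * (n + 1) + n) + 1 := by ring
    rw [e]
    refine eq_of_deriv (by simp) ?_
    have h := mul_dpowAux f (m * (n + 1)) n
    have hc : (m * (n + 1) + n).choose (m * (n + 1)) = (m * (n + 1) + n).choose n :=
      Nat.choose_symm_add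
    rw [hc] at h
    rw [Nat.uniformBell_succ_left]
    simp only [deriv_dpowAux, deriv_mul, deriv_natCast, zero_mul, zero_add, ih]
    have h2 : m * (n + 1) + (n + 1) - 1 = m * (n + 1) + n := by omega
    rw [h2, Nat.add_sub_cancel, Nat.cast_mul]
    linear_combination ((m.uniformBell (n + 1) : ℕ) * deriv f) * h

open Classical in
/-- The standard system of divided powers `f ↦ f^(r)` on the series without constant term. -/
noncomputable def dividedPowers (k : Type u) [Field k] : DividedPowers (maxIdeal k) where
  dpow r f := if f ∈ maxIdeal k then dpowAux f r else 0
  dpow_null h := if_neg h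
  dpow_zero h := if_pos h
  dpow_one h := by rw [if_pos h]; exact dpowAux_one h
  dpow_mem {n f} hn h := by
    obtain ⟨n, rfl⟩ := Nat.exists_eq_succ_of_ne_zero hn
    rw [if_pos h]; rfl
  dpow_add hf hg := by
    simp only [if_pos hf, if_pos hg, if_pos ((maxIdeal k).add_mem hf hg)]
    exact dpowAux_add _
  dpow_mul {n a f} h := by
    rw [if_pos h, if_pos ((maxIdeal k).mul_mem_left a h)]; exact dpowAux_mul h n
  mul_dpow h := by
    rw [if_pos h, if_pos h, if_pos h]; exact mul_dpowAux _ _ _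
  dpow_comp {m n f} hn h := by
    have h' : dpowAux f n ∈ maxIdeal k := by
      obtain ⟨n, rfl⟩ := Nat.exists_eq_succ_of_ne_zero hn
      rfl
    rw [if_pos h, if_pos h', if_pos h]; exact dpowAux_comp f m hn

theorem dpow_eq {f : DPSeries k} (hf : f ∈ maxIdeal k) (r : ℕ) :
    (dividedPowers k).dpow r f = dpowAux f r := if_pos hf

@[simp] theorem deriv_x_succ (a : ℕ) : deriv (x (a + 1) : DPSeries k) = x a := by
  ext c; simp [x_apply]

theorem x_one_mem : (x 1 : DPSeries k) ∈ maxIdeal k := by simp [mem_maxIdeal, x_apply]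

/-- The divided powers of the variable are the basis elements. -/
theorem dpow_x (r : ℕ) : (dividedPowers k).dpow r (x 1) = x r := by
  rw [dpow_eq x_one_mem]
  induction r with
  | zero => rfl
  | succ r ih =>
    refine eq_of_deriv (by simp [x_apply]) ?_
    rw [deriv_dpowAux, ih, deriv_x_succ, deriv_x_succ]
    exact mul_one _

theorem deriv_dpow {f : DPSeries k} (hf : f ∈ maxIdeal k) (r : ℕ) :
    deriv ((dividedPowers k).dpow (r + 1) f) = (dividedPowers k).dpow r f * deriv f := by
  rw [dpow_eq hf, dpow_eq hf, deriv_dpowAux]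

theorem x_mul_x (a b : ℕ) :
    (x a : DPSeries k) * x b = ((a + b).choose a : k) • x (a + b) := by
  have h := (dividedPowers k).mul_dpow (m := a) (n := b) (x_one_mem (k := k))
  rw [dpow_x, dpow_x, dpow_x] at h
  rw [h, Nat.cast_smul_eq_nsmul, nsmul_eq_mul]

end DPSeries

open DPSeries hiding deriv add_apply smul_apply zero_apply

theorem dvd_choose_of_carry {p n a b : ℕ} (hp : p.Prime) (ha : a < p ^ n) (hb : b < p ^ n)
    (h : p ^ n ≤ a + b) : p ∣ (a + b).choose a := by
  obtain ⟨c, hc⟩ := Nat.exists_eq_add_of_le h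
  rw [hc, Nat.add_choose_eq]
  refine Finset.dvd_sum ?_
  rintro ⟨i, j⟩ hij
  have hij' : i + j = a := by simpa using hij
  rcases Nat.eq_zero_or_pos i with rfl | hi
  · have : c < j := by omega
    simp [Nat.choose_eq_zero_of_lt this]
  · exact Dvd.dvd.mul_right (hp.dvd_choose_pow (by omega) (by omega)) _

variable (k : Type u) [Field k] (p : ℕ) [Fact p.Prime] [CharP k p] (n : ℕ)

/-- The divided power algebra `O(1;n)`: the span of the `x^(a)` with `a < p ^ n`. -/
def O : Subalgebra k (DPSeries k) where
  carrier := {f | ∀ a, p ^ n ≤ a → f a = 0}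
  add_mem' := fun {f g} hf hg a ha => by simp [hf a ha, hg a ha]
  mul_mem' := fun {f g} hf hg c hc => by
    rw [mul_apply]
    refine Finset.sum_eq_zero ?_
    rintro ⟨a, b⟩ hab
    have hab' : a + b = c := by simpa using hab
    by_cases ha : p ^ n ≤ a
    · simp [hf a ha]
    by_cases hb : p ^ n ≤ b
    · simp [hg b hb]
    have := dvd_choose_of_carry (Fact.out : p.Prime) (not_le.1 ha) (not_le.1 hb) (by omega)
    rw [hab'] at this
    simp [(CharP.cast_eq_zero_iff k p _).2 this]
  algebraMap_mem' := fun r a ha => by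
    have : 0 < p ^ n := pow_pos (Fact.out : p.Prime).pos n
    have ha0 : a ≠ 0 := by omega
    rw [Algebra.algebraMap_eq_smul_one]
    simp [one_apply, ha0]

variable {k p n}

theorem mem_O {f : DPSeries k} : f ∈ O k p n ↔ ∀ a, p ^ n ≤ a → f a = 0 := Iff.rfl

theorem x_mem {a : ℕ} (ha : a < p ^ n) : (x a : DPSeries k) ∈ O k p n := fun b hb => by
  have : b ≠ a := by omega
  simp [x_apply, this]

variable (k p n) in
/-- The basis element `x^(a)` of `O(1;n)` for `a < p ^ n`, and `0` for `a ≥ p ^ n`. -/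
def X (a : ℕ) : O k p n := if h : a < p ^ n then ⟨x a, x_mem h⟩ else 0

theorem coe_X {a : ℕ} (h : a < p ^ n) : (X k p n a : DPSeries k) = x a := by
  rw [X, dif_pos h]

theorem X_of_le {a : ℕ} (h : p ^ n ≤ a) : X k p n a = 0 := dif_neg (not_lt.2 h)

/-- The product rule on the basis; the right side is `0` if `a + b ≥ p ^ n`. -/
theorem X_mul_X {a b : ℕ} (ha : a < p ^ n) (hb : b < p ^ n) :
    X k p n a * X k p n b = ((a + b).choose a : k) • X k p n (a + b) := by
  apply Subtype.ext
  rw [MulMemClass.coe_mul, coe_X ha, coe_X hb, x_mul_x]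
  by_cases h : a + b < p ^ n
  · rw [← coe_X h]; rfl
  · have := dvd_choose_of_carry (Fact.out : p.Prime) ha hb (not_lt.1 h)
    rw [(CharP.cast_eq_zero_iff k p _).2 this, zero_smul, zero_smul]; rfl

variable (k p n) in
/-- The special derivation `∂` of `O(1;n)`. -/
def del : Derivation k (O k p n) (O k p n) :=
  Derivation.mk'
    { toFun := fun f => ⟨DPSeries.deriv (f : DPSeries k), fun a ha => f.2 (a + 1) (by omega)⟩
      map_add' := fun _ _ => rfl
      map_smul' := fun _ _ => rfl }
    (fun a b => by
      apply Subtype.ext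
      change DPSeries.deriv ((a : DPSeries k) * (b : DPSeries k)) =
        (a : DPSeries k) * DPSeries.deriv (b : DPSeries k) +
          (b : DPSeries k) * DPSeries.deriv (a : DPSeries k)
      rw [DPSeries.deriv_mul]; ring)

theorem coe_del (f : O k p n) : (del k p n f : DPSeries k) = DPSeries.deriv (f : DPSeries k) := rfl

theorem del_X {a : ℕ} (h : a + 1 < p ^ n) : del k p n (X k p n (a + 1)) = X k p n a :=
  Subtype.ext (by rw [coe_del, coe_X h, coe_X (by omega), deriv_x_succ])

/-- A derivation `D` of `O(1;n)` is special if `D x^(a) = x^(a - 1) D x` for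
`1 ≤ a ≤ p ^ n - 1`. -/
def IsSpecial (D : Derivation k (O k p n) (O k p n)) : Prop :=
  ∀ a, 1 ≤ a → a ≤ p ^ n - 1 → D (X k p n a) = X k p n (a - 1) * D (X k p n 1)

theorem X_zero : X k p n 0 = 1 :=
  Subtype.ext (coe_X (pow_pos (Fact.out : p.Prime).pos n))

theorem lt_of_le_pred {a : ℕ} (h : a ≤ p ^ n - 1) : a < p ^ n := by
  have : 0 < p ^ n := pow_pos (Fact.out : p.Prime).pos n
  omega

variable (k p n) in
/-- The Zassenhaus algebra `W(1;n)`: the special derivations of `O(1;n)`. -/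
def W : LieSubalgebra k (Derivation k (O k p n) (O k p n)) where
  carrier := {D | IsSpecial D}
  add_mem' := fun {D E} hD hE a h1 h2 => by
    simp only [Derivation.add_apply, hD a h1 h2, hE a h1 h2, mul_add]
  zero_mem' := fun a _ _ => by simp
  smul_mem' := fun r D hD a h1 h2 => by
    simp only [Derivation.smul_apply, hD a h1 h2, mul_smul_comm]
  lie_mem' := fun {D E} hD hE a h1 h2 => by
    rw [Derivation.commutator_apply, Derivation.commutator_apply, hD a h1 h2, hE a h1 h2]
    rcases eq_or_lt_of_le h1 with rfl | h
    · simp [X_zero]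
    · rw [Derivation.leibniz, Derivation.leibniz, hD (a - 1) (by omega) (by omega),
        hE (a - 1) (by omega) (by omega)]
      simp only [smul_eq_mul]
      ring

theorem smul_del_special (f : O k p n) : IsSpecial (f • del k p n) := fun a h1 h2 => by
  obtain ⟨b, rfl⟩ : ∃ b, a = b + 1 := ⟨a - 1, by omega⟩
  have hb : b + 1 < p ^ n := lt_of_le_pred h2
  have h01 : 0 + 1 < p ^ n := by omega
  have e : del k p n (X k p n 1) = 1 := by rw [← X_zero]; exact del_X h01
  rw [Derivation.smul_apply, Derivation.smul_apply, del_X hb, e, Nat.add_sub_cancel]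
  simp [mul_comm]

variable (k p n) in
/-- The element `f ∂` of `W(1;n)`. -/
def mulDel (f : O k p n) : W k p n := ⟨f • del k p n, smul_del_special f⟩

theorem eq_sum_X (f : O k p n) :
    f = ∑ a ∈ Finset.range (p ^ n), (f : DPSeries k) a • X k p n a := by
  apply Subtype.ext
  rw [AddSubmonoidClass.coe_finsetSum]
  have hs : ∀ (s : Finset ℕ) (F : ℕ → DPSeries k) (c : ℕ),
      (∑ i ∈ s, F i) c = ∑ i ∈ s, F i c := fun s F c => by
    induction s using Finset.induction_on with
    | empty => simp
    | insert a s ha h => rw [Finset.sum_insert ha, Finset.sum_insert ha, DPSeries.add_apply, h]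
  ext c
  rw [hs]
  have : ∀ a ∈ Finset.range (p ^ n),
      (((f : DPSeries k) a • X k p n a : O k p n) : DPSeries k) c
        = if a = c then (f : DPSeries k) c else 0 := by
    intro a ha
    rw [SetLike.val_smul, coe_X (Finset.mem_range.1 ha), DPSeries.smul_apply, x_apply]
    by_cases h : a = c
    · simp [h]
    · simp [h, Ne.symm h]
  rw [Finset.sum_congr rfl this, Finset.sum_ite_eq']
  split_ifs with h
  · rfl
  · exact f.2 c (not_lt.1 fun h' => h (Finset.mem_range.2 h'))

/-- Every special derivation `D` equals `D(x) ∂`. -/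
theorem special_apply {D : Derivation k (O k p n) (O k p n)} (hD : IsSpecial D) (f : O k p n) :
    D f = D (X k p n 1) * del k p n f := by
  have h : ∀ a ∈ Finset.range (p ^ n),
      D (X k p n a) = D (X k p n 1) * del k p n (X k p n a) := by
    intro a ha
    have ha' := Finset.mem_range.1 ha
    rcases a with _ | a
    · rw [X_zero]; simp
    · rw [hD (a + 1) (by omega) (by omega), del_X ha', Nat.add_sub_cancel, mul_comm]
  rw [eq_sum_X f]
  simp only [map_sum, Derivation.map_smul, Finset.mul_sum, mul_smul_comm]
  exact Finset.sum_congr rfl fun a ha => by rw [h a ha]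

/-- `HasDPow f r g` says that `f` lies in the maximal ideal of `O(1;n)`, and that its divided
power `f^(r)` lies in `O(1;n)` and is equal to `g`. -/
def HasDPow (f : O k p n) (r : ℕ) (g : O k p n) : Prop :=
  (f : DPSeries k) ∈ maxIdeal k ∧ (dividedPowers k).dpow r (f : DPSeries k) = g

variable (k p n) in
/-- The group `G` of the admissible automorphisms of `O(1;n)`: those with
`Φ (f^(r)) = (Φ f)^(r)` for all `f` in the maximal ideal and all `r`. Divided powers of elements
of `O(1;n)` can leave `O(1;n)` (for example the `p`-th divided power of `x^(p^(n-1))`), so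
that the equation means: either side lies in `O(1;n)` if the other does, and they agree. -/
def G : Subgroup (O k p n ≃ₐ[k] O k p n) where
  carrier := {Φ | ∀ (f : O k p n) (r : ℕ) (g : O k p n), HasDPow f r g ↔ HasDPow (Φ f) r (Φ g)}
  mul_mem' := fun {Φ Ψ} hΦ hΨ f r g => (hΨ f r g).trans (hΦ (Ψ f) r (Ψ g))
  one_mem' := fun _ _ _ => Iff.rfl
  inv_mem' := fun {Φ} hΦ f r g => by
    have h := hΦ (Φ⁻¹ f) r (Φ⁻¹ g)
    have e : ∀ f, Φ (Φ⁻¹ f) = f := fun f => AlgEquiv.apply_symm_apply Φ f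
    rw [e, e] at h
    exact h.symm

/-- The derivation `Φ D Φ⁻¹`. -/
def conj (Φ : O k p n ≃ₐ[k] O k p n) (D : Derivation k (O k p n) (O k p n)) :
    Derivation k (O k p n) (O k p n) :=
  Derivation.mk' (Φ.toLinearMap ∘ₗ (D : O k p n →ₗ[k] O k p n) ∘ₗ Φ.symm.toLinearMap)
    (fun a b => by simp [Derivation.leibniz])

theorem conj_apply (Φ : O k p n ≃ₐ[k] O k p n) (D : Derivation k (O k p n) (O k p n))
    (f : O k p n) : conj Φ D f = Φ (D (Φ.symm f)) := rfl

theorem conj_special {Φ : O k p n ≃ₐ[k] O k p n} (hΦ : Φ ∈ G k p n)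
    {D : Derivation k (O k p n) (O k p n)} (hD : IsSpecial D) : IsSpecial (conj Φ D) := by
  intro a h1 h2
  have hx : ∀ b, b < p ^ n → HasDPow (Φ.symm (X k p n 1)) b (Φ.symm (X k p n b)) := by
    intro b hb
    have h1n : 1 < p ^ n := lt_of_le_of_lt h1 (lt_of_le_pred h2)
    refine (hΦ _ b _).2 ?_
    rw [AlgEquiv.apply_symm_apply, AlgEquiv.apply_symm_apply, HasDPow, coe_X h1n, coe_X hb]
    exact ⟨x_one_mem, dpow_x b⟩
  obtain ⟨b, rfl⟩ : ∃ b, a = b + 1 := ⟨a - 1, by omega⟩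
  have hb1 := lt_of_le_pred h2
  rw [Nat.add_sub_cancel]
  have e : del k p n (Φ.symm (X k p n (b + 1)))
      = Φ.symm (X k p n b) * del k p n (Φ.symm (X k p n 1)) := by
    apply Subtype.ext
    rw [coe_del, ← (hx (b + 1) hb1).2, deriv_dpow (hx (b + 1) hb1).1, (hx b (by omega)).2]
    rfl
  rw [conj_apply, conj_apply, special_apply hD, e, special_apply hD (Φ.symm (X k p n 1))]
  simp only [map_mul, AlgEquiv.apply_symm_apply]
  ring

/-- The automorphism `D ↦ Φ D Φ⁻¹` of `W(1;n)` induced by an admissible automorphism `Φ`. -/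
def conjW (Φ : G k p n) : W k p n ≃ₗ⁅k⁆ W k p n where
  toFun D := ⟨conj Φ.1 D.1, conj_special Φ.2 D.2⟩
  map_add' D E := by ext f; simp [conj_apply]
  map_smul' r D := by ext f; simp [conj_apply]
  map_lie' {D E} := by
    apply Subtype.ext
    ext f
    simp [conj_apply, Derivation.commutator_apply]
  invFun D := ⟨conj (Φ⁻¹).1 D.1, conj_special (Φ⁻¹).2 D.2⟩
  left_inv D := by
    apply Subtype.ext
    ext f
    refine congrArg (fun g : O k p n => (g : DPSeries k) _)
      ((AlgEquiv.symm_apply_apply Φ.1 _).trans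
        (congrArg D.1 (AlgEquiv.symm_apply_apply Φ.1 f)))
  right_inv D := by
    apply Subtype.ext
    ext f
    refine congrArg (fun g : O k p n => (g : DPSeries k) _)
      ((AlgEquiv.apply_symm_apply Φ.1 _).trans
        (congrArg D.1 (AlgEquiv.apply_symm_apply Φ.1 f)))

-- Associative algebras carry the commutator bracket.
attribute [local instance 100] LieRing.ofAssociativeRing

variable (k p n) in
/-- The minimal `p`-envelope `W(1;n)_p`: the smallest Lie algebra of linear endomorphisms of
`W(1;n)` that contains `ad W(1;n)` and is closed under `p`-th powers. As the derivations of
`W(1;n)` form such a Lie algebra, it consists of derivations and its `[p]`-th power map is the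
usual `p`-th power. -/
def Wp : LieSubalgebra k (Module.End k (W k p n)) :=
  sInf {S | (LieAlgebra.ad k (W k p n)).range ≤ S ∧ ∀ E ∈ S, E ^ p ∈ S}

variable (k p n) in
/-- The filtration subspace `W(1;n)_(0)`, spanned by the `x^(a) ∂` with `1 ≤ a ≤ p ^ n - 1`,
seen inside `W(1;n)_p` through `ad`. -/
def adW0 : Submodule k (Module.End k (W k p n)) :=
  Submodule.span k
    {E | ∃ a, 1 ≤ a ∧ a ≤ p ^ n - 1 ∧ E = LieAlgebra.ad k (W k p n) (mulDel k p n (X k p n a))}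

variable (k p n) in
/-- The variety of nilpotent elements of `W(1;n)_p`: those with `E^(p^N) = 0` for `N ≫ 0`. -/
def nilpotentVariety : Set (Module.End k (W k p n)) :=
  {E | E ∈ Wp k p n ∧ ∃ N₀, ∀ N, N₀ ≤ N → E ^ p ^ N = 0}

variable (k p n) in
/-- The nilpotent elements `E` of `W(1;n)_p` such that `E^(p^(n-1))` is not in `W(1;n)_(0)`. -/
def nilpotentReg : Set (Module.End k (W k p n)) :=
  {E | E ∈ nilpotentVariety k p n ∧ E ^ p ^ (n - 1) ∉ adW0 k p n}

variable (k p n) in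
/-- The element `∂^(p^i)` of `W(1;n)_p`. -/
def delPow (i : ℕ) : Module.End k (W k p n) :=
  LieAlgebra.ad k (W k p n) (mulDel k p n 1) ^ p ^ i

/-- The action of an admissible automorphism on the endomorphisms (in particular, on the
derivations) of `W(1;n)`: conjugation by the automorphism of `W(1;n)` that it induces. -/
def act (Φ : G k p n) : Module.End k (W k p n) → Module.End k (W k p n) :=
  (conjW Φ).toLinearEquiv.conj

end Zassenhaus

/-! Every element `E` of the `p`-envelope is `ad D` for a derivation `D` of `O(1;n)` normalizing
`W(1;n)`, and `D` is determined by `E` (`exists_normalizerPairs_of_mem_Wp`,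
`eq_zero_of_normalizerPairs`). So the work takes place on `O(1;n)`, of dimension `p^n`, where `E`
nilpotent gives `D^(p^n) = 0`. The key tool is the vector in `k^n` of the constant terms of the `D
x^(p^i)`, `i < n`. Its vanishing forces `D` into `W_(0)` (`exists_eq_ad_mulDel`), and for `∂^(p^j)`
it is the `j`-th unit vector.

Let `D` be regular nilpotent. If a nontrivial combination of the `D^(p^j)`, `j < n`, had zero
vector, a suitable `p`-power of it would be a nonzero multiple of `D^(p^(n-1))` with values in the
maximal ideal, against regularity. So the `n` vectors form a basis of `k^n`, and some combination
`F` of the `D^(p^j)` has the vector of `∂`, whence `F = (1 + f)∂` with `f` in the maximal ideal.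

Now `F` is nilpotent with one-dimensional kernel, a single Jordan block. This makes the divided
powers of an antiderivative `y` of `(1 + f)⁻¹` stay in `O(1;n)`, and `x^(a) ↦ y^(a)` is an
admissible automorphism carrying `∂` to `F` (`exists_conjW_eq_mulDel`). As `D` commutes with `F`, a
conjugate of `D` centralizes `∂`, hence is a combination of the `∂^(p^i)` (`eq_sum_delPow`). Its
`p^(n-1)`-th power is `c_0^(p^(n-1)) ∂^(p^(n-1))`, so regularity amounts to `c_0 ≠ 0`. Conversely,
no conjugate of a nonzero multiple of `∂^(p^(n-1))` lies in `W_(0)`, since `G` preserves the maximal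
ideal.

For the normal form, the substitution `x ↦ r x` with `r^(p^t) = c_t` makes the last nonzero
coefficient equal to `1`. -/

namespace Zassenhaus

open Finset

universe u

/-! ### Substitution in divided power series. -/

namespace DPSeries

variable {k : Type u} [Field k]

theorem mul_apply_congr {f f' g g' : DPSeries k} {c : ℕ} (hf : ∀ i ≤ c, f i = f' i)
    (hg : ∀ i ≤ c, g i = g' i) : (f * g) c = (f' * g') c := by
  rw [mul_apply, mul_apply]
  refine Finset.sum_congr rfl ?_
  rintro ⟨a, b⟩ h
  have h' : a + b = c := by simpa using h
  simp only
  rw [hf a (by omega), hg b (by omega)]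

instance : Nontrivial (DPSeries k) :=
  ⟨0, 1, fun h => zero_ne_one (α := k) (DFunLike.congr_fun h 0)⟩

theorem pow_char_apply (p : ℕ) [Fact p.Prime] [CharP k p] (f : DPSeries k) :
    f ^ p = algebraMap k (DPSeries k) (f 0 ^ p) := by
  have hp : p.Prime := Fact.out
  have : CharP (DPSeries k) p := charP_of_injective_algebraMap (algebraMap k _).injective p
  -- Without constant term, `g^p = p! g^(p)`, and `p! = 0` in `k`.
  have h1 : ∀ g : DPSeries k, g 0 = 0 → g ^ p = 0 := fun g hg => by
    rw [← (dividedPowers k).factorial_mul_dpow_eq_pow (mem_maxIdeal.2 hg),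
      (CharP.cast_eq_zero_iff (DPSeries k) p _).2 (hp.dvd_factorial.2 le_rfl), zero_mul]
  have h2 := h1 (f - algebraMap k _ (f 0)) (by
    rw [sub_eq_add_neg, add_apply, ← neg_one_smul k, smul_apply, Algebra.algebraMap_eq_smul_one,
      smul_apply, one_apply]
    simp)
  rw [sub_pow_char, sub_eq_zero] at h2
  rw [h2, map_pow]

/-- This makes substitution a finite sum in each degree, which may be extended to any longer range.
-/
theorem dpowAux_apply_of_lt (y : DPSeries k) {a c : ℕ} (h : c < a) : dpowAux y a c = 0 := by
  induction a generalizing c with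
  | zero => omega
  | succ a ih =>
    rcases c with _ | c
    · rfl
    · rw [← deriv_apply, deriv_dpowAux, mul_apply]
      refine Finset.sum_eq_zero ?_
      rintro ⟨i, j⟩ hij
      have hij' : i + j = c := by simpa using hij
      rw [ih (by omega : i < a), zero_mul, mul_zero]

/-- The substitution `x^(a) ↦ y^(a)`. -/
def subst (y f : DPSeries k) : DPSeries k :=
  ⟨fun c => ∑ a ∈ Finset.range (c + 1), f a * dpowAux y a c⟩

theorem subst_apply {y f : DPSeries k} {c N : ℕ} (h : c < N) :
    subst y f c = ∑ a ∈ Finset.range N, f a * dpowAux y a c := by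
  refine Finset.sum_subset (Finset.range_subset_range.2 h) fun a _ ha => ?_
  rw [dpowAux_apply_of_lt y (by simpa using ha), mul_zero]

@[simp] theorem subst_apply_zero (y f : DPSeries k) : subst y f 0 = f 0 := by
  rw [subst_apply (Nat.lt_succ_self 0)]
  simp [one_apply]

theorem subst_add (y f g : DPSeries k) : subst y (f + g) = subst y f + subst y g := by
  ext c
  simp only [add_apply, subst_apply (Nat.lt_succ_self c), add_mul, Finset.sum_add_distrib]

theorem subst_smul (y : DPSeries k) (r : k) (f : DPSeries k) :
    subst y (r • f) = r • subst y f := by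
  ext c
  simp only [smul_apply, subst_apply (Nat.lt_succ_self c), Finset.mul_sum, mul_assoc]

theorem subst_x (y : DPSeries k) (a : ℕ) : subst y (x a) = dpowAux y a := by
  ext c
  rw [subst_apply (N := c + a + 1) (by omega)]
  simp [x_apply]

theorem subst_one (y : DPSeries k) : subst y 1 = 1 := subst_x y 0

theorem deriv_subst (y f : DPSeries k) : deriv (subst y f) = subst y (deriv f) * deriv y := by
  ext c
  rw [deriv_apply, subst_apply (Nat.lt_succ_self (c + 1)), Finset.sum_range_succ', mul_apply]
  have e : ∀ ij ∈ antidiagonal c, (c.choose ij.1 : k) * (subst y (deriv f) ij.1 * deriv y ij.2)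
      = ∑ b ∈ Finset.range (c + 1),
        f (b + 1) * ((c.choose ij.1 : k) * (dpowAux y b ij.1 * deriv y ij.2)) := by
    rintro ⟨i, j⟩ hij
    have hij' : i + j = c := by simpa using hij
    rw [subst_apply (N := c + 1) (by simp only; omega), Finset.sum_mul, Finset.mul_sum]
    exact Finset.sum_congr rfl fun b _ => by rw [deriv_apply f]; ring
  rw [Finset.sum_congr rfl e, Finset.sum_comm]
  simp only [← Finset.mul_sum]
  rw [dpowAux_zero, one_apply, if_neg (Nat.succ_ne_zero c), mul_zero, add_zero]
  refine Finset.sum_congr rfl fun b _ => ?_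
  rw [← deriv_apply (dpowAux y (b + 1)), deriv_dpowAux, mul_apply]

theorem subst_mul (y f g : DPSeries k) : subst y (f * g) = subst y f * subst y g := by
  -- Induction on the degree by differentiating. The factor `deriv y` mixes degrees, so the claim is
  -- needed in all degrees up to `c`.
  have key : ∀ (c : ℕ) (f g : DPSeries k), ∀ i ≤ c,
      subst y (f * g) i = (subst y f * subst y g) i := by
    intro c
    induction c with
    | zero =>
      intro f g i hi
      obtain rfl : i = 0 := by omega
      simp
    | succ c ih =>
      intro f g i hi
      rcases i with _ | i
      · simp
      · rw [← deriv_apply, ← deriv_apply, deriv_subst, deriv_mul, deriv_mul, deriv_subst,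
          deriv_subst]
        have e : subst y f * (subst y (deriv g) * deriv y) + subst y (deriv f) * deriv y *
            subst y g = (subst y (deriv f) * subst y g + subst y f * subst y (deriv g)) *
              deriv y := by ring
        rw [add_comm (subst y (deriv f) * deriv y * subst y g), e]
        refine mul_apply_congr (fun j hj => ?_) fun _ _ => rfl
        rw [subst_add, add_apply, add_apply, ih _ _ j (by omega), ih _ _ j (by omega)]
  exact ext fun c => key c f g c le_rfl

theorem subst_dpowAux (y f : DPSeries k) (r : ℕ) :
    subst y (dpowAux f r) = dpowAux (subst y f) r := by
  induction r with
  | zero => exact subst_one y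
  | succ r ih =>
    refine eq_of_deriv (by simp) ?_
    rw [deriv_subst, deriv_dpowAux, deriv_dpowAux, subst_mul, ih, deriv_subst, mul_assoc]

/-- If `subst y f = 0`, differentiating and cancelling the unit `deriv y` gives `subst y (deriv f) =
0`, so the coefficients of `f` vanish one after another. -/
theorem subst_injective {y : DPSeries k} (hy : IsUnit (deriv y)) :
    Function.Injective (subst y) := by
  have key : ∀ (c : ℕ) (f : DPSeries k), subst y f = 0 → f c = 0 := by
    intro c
    induction c with
    | zero => intro f h; rw [← subst_apply_zero y, h, zero_apply]
    | succ c ih =>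
      intro f h
      rw [← deriv_apply]
      refine ih _ (hy.mul_left_eq_zero.1 ?_)
      rw [← deriv_subst, h, map_zero]
  intro f g h
  have h1 : subst y (f + (-1 : k) • g) = 0 := by
    rw [subst_add, subst_smul, h, neg_one_smul, add_neg_cancel]
  ext c
  have h2 := key c _ h1
  rw [neg_one_smul, ← sub_eq_add_neg] at h2
  exact sub_eq_zero.1 h2

end DPSeries

/-! ### The algebra `O(1;n)` and its admissible automorphisms. -/

open DPSeries hiding deriv add_apply smul_apply zero_apply

variable {k : Type u} [Field k] {p : ℕ} [Fact p.Prime] [CharP k p] {n : ℕ}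

variable (k p n) in
/-- The coordinates of an element of `O(1;n)` in the basis of the `x^(a)`. -/
def coeffEquiv : O k p n ≃ₗ[k] (Fin (p ^ n) → k) where
  toFun f a := (f : DPSeries k) a
  map_add' _ _ := rfl
  map_smul' _ _ := rfl
  invFun v := ⟨⟨fun a => if h : a < p ^ n then v ⟨a, h⟩ else 0⟩, fun _ ha => dif_neg (not_lt.2 ha)⟩
  left_inv f := by
    apply Subtype.ext
    ext a
    by_cases h : a < p ^ n
    · exact dif_pos h
    · exact (dif_neg h).trans (f.2 a (not_lt.1 h)).symm
  right_inv v := funext fun a => dif_pos a.2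

instance : FiniteDimensional k (O k p n) := Module.Finite.equiv (coeffEquiv k p n).symm

theorem finrank_O : Module.finrank k (O k p n) = p ^ n := by
  rw [(coeffEquiv k p n).finrank_eq, Module.finrank_fin_fun]

instance : Nontrivial (O k p n) :=
  ⟨0, 1, fun h => zero_ne_one (α := DPSeries k) (congrArg Subtype.val h)⟩

/-- The `p`-th power of `f` is the nonzero scalar `f(0)^p`. -/
theorem isUnit_of_coe_apply_zero_ne_zero {f : O k p n} (hf : (f : DPSeries k) 0 ≠ 0) :
    IsUnit f := by
  have hp : p ≠ 0 := (Fact.out : p.Prime).ne_zero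
  have h : f ^ p = algebraMap k (O k p n) ((f : DPSeries k) 0 ^ p) :=
    Subtype.ext (pow_char_apply p (f : DPSeries k))
  rw [← isUnit_pow_iff hp, h]
  exact (isUnit_iff_ne_zero.2 (pow_ne_zero p hf)).map (algebraMap k (O k p n))

variable (k p n) in
/-- The derivation `∂` as a linear endomorphism of `O(1;n)`. -/
def delEnd : Module.End k (O k p n) := (del k p n : O k p n →ₗ[k] O k p n)

theorem delEnd_apply (f : O k p n) : delEnd k p n f = del k p n f := rfl

theorem coe_delEnd_pow_apply (m : ℕ) (f : O k p n) (c : ℕ) :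
    ((delEnd k p n ^ m) f : DPSeries k) c = (f : DPSeries k) (c + m) := by
  induction m generalizing c with
  | zero => rfl
  | succ m ih =>
    rw [pow_succ', Module.End.mul_apply, delEnd_apply, coe_del, deriv_apply, ih]
    congr 1; ring

theorem delEnd_pow_eq_zero {m : ℕ} (hm : p ^ n ≤ m) : delEnd k p n ^ m = 0 := by
  refine LinearMap.ext fun f => Subtype.ext (DPSeries.ext fun c => ?_)
  rw [coe_delEnd_pow_apply]
  exact f.2 _ (by omega)

/-- The endomorphism of `O(1;n)` with `x^(a) ↦ y^(a)`, if all these divided powers lie in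
`O(1;n)`. -/
def substHom (y : DPSeries k) (hy : ∀ a < p ^ n, dpowAux y a ∈ O k p n) :
    O k p n →ₐ[k] O k p n :=
  AlgHom.ofLinearMap
    { toFun := fun f => ⟨subst y f, fun c hc => by
        rw [subst_apply (Nat.lt_succ_self c)]
        refine Finset.sum_eq_zero fun a _ => ?_
        by_cases ha : a < p ^ n
        · rw [hy a ha c hc, mul_zero]
        · rw [f.2 a (not_lt.1 ha), zero_mul]⟩
      map_add' := fun f g => Subtype.ext (subst_add y f g)
      map_smul' := fun r f => Subtype.ext (subst_smul y r f) }
    (Subtype.ext (subst_one y))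
    (fun f g => Subtype.ext (subst_mul y f g))

theorem coe_substHom (y : DPSeries k) (hy : ∀ a < p ^ n, dpowAux y a ∈ O k p n) (f : O k p n) :
    (substHom y hy f : DPSeries k) = subst y f := rfl

theorem substHom_bijective {y : DPSeries k} (hy : ∀ a < p ^ n, dpowAux y a ∈ O k p n)
    (hu : IsUnit (DPSeries.deriv y)) : Function.Bijective (substHom y hy) := by
  have h : Function.Injective (substHom y hy).toLinearMap := fun f g hfg =>
    Subtype.ext (subst_injective hu (congrArg Subtype.val hfg))
  exact ⟨h, LinearMap.injective_iff_surjective.1 h⟩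

theorem substHom_mem_G {y : DPSeries k} (hy : ∀ a < p ^ n, dpowAux y a ∈ O k p n)
    (hu : IsUnit (DPSeries.deriv y)) :
    AlgEquiv.ofBijective (substHom y hy) (substHom_bijective hy hu) ∈ G k p n := by
  intro f r g
  have h0 : ∀ f : O k p n, (f : DPSeries k) ∈ maxIdeal k ↔
      (substHom y hy f : DPSeries k) ∈ maxIdeal k := fun f => by
    rw [mem_maxIdeal, mem_maxIdeal, coe_substHom, subst_apply_zero]
  refine and_congr_right_iff.2 ?_ |>.trans (and_congr_left' (h0 f))
  intro hf
  change _ ↔ (dividedPowers k).dpow r (subst y f) = subst y g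
  rw [dpow_eq hf, dpow_eq (f := subst y f) ((h0 f).1 hf), ← subst_dpowAux]
  -- The substitution is injective on all series, not only on `O(1;n)`, so the equation can be
  -- pulled back even when a divided power might leave `O(1;n)`.
  exact (subst_injective hu).eq_iff.symm

/-- The admissible automorphism with `x^(a) ↦ y^(a)`. -/
noncomputable def substG (y : DPSeries k) (hy : ∀ a < p ^ n, dpowAux y a ∈ O k p n)
    (hu : IsUnit (DPSeries.deriv y)) : G k p n :=
  ⟨_, substHom_mem_G hy hu⟩

theorem coe_substG_apply {y : DPSeries k} (hy : ∀ a < p ^ n, dpowAux y a ∈ O k p n)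
    (hu : IsUnit (DPSeries.deriv y)) (f : O k p n) :
    ((substG y hy hu).1 f : DPSeries k) = subst y f := rfl

/-- The automorphism `x^(a) ↦ y^(a)` carries `∂` to `g∂` if `g y' = 1`. -/
theorem conj_substG {y : DPSeries k} (hy : ∀ a < p ^ n, dpowAux y a ∈ O k p n)
    (hu : IsUnit (DPSeries.deriv y)) {g : O k p n} (hg : (g : DPSeries k) * DPSeries.deriv y = 1) :
    conjW (substG y hy hu) (mulDel k p n 1) = mulDel k p n g := by
  have h : ∀ f, (substG y hy hu).1 (del k p n f) = g * del k p n ((substG y hy hu).1 f) := by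
    intro f
    apply Subtype.ext
    rw [coe_substG_apply, MulMemClass.coe_mul, coe_del, coe_del, coe_substG_apply, deriv_subst]
    linear_combination (-subst y (DPSeries.deriv (f : DPSeries k))) * hg
  apply Subtype.ext
  apply Derivation.ext
  intro f
  obtain ⟨f, rfl⟩ := (substG y hy hu).1.surjective f
  change (substG y hy hu).1 ((1 : O k p n) * del k p n ((substG y hy hu).1.symm _)) = g * del k p n _
  rw [AlgEquiv.symm_apply_apply, one_mul, h]

/-- For `r = 1`, admissibility says just that the maximal ideal is preserved. -/
theorem apply_coe_zero_eq_zero_iff (Φ : G k p n) (f : O k p n) :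
    (Φ.1 f : DPSeries k) 0 = 0 ↔ (f : DPSeries k) 0 = 0 := by
  have h := Φ.2 f 1 f
  have e : ∀ f : O k p n, HasDPow f 1 f ↔ (f : DPSeries k) 0 = 0 := fun f =>
    ⟨fun h => h.1, fun h => ⟨h, (dividedPowers k).dpow_one h⟩⟩
  rw [e, e] at h
  exact h.symm

-- Derivations of `O(1;n)` that normalize `W(1;n)`.

attribute [local instance 100] LieRing.ofAssociativeRing

/-- Left and right multiplication by `a` commute, so Frobenius is additive on their difference. -/
theorem ad_pow_char_pow {k A : Type*} [Field k] [Ring A] [Algebra k A] [Nontrivial A] (p : ℕ)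
    [Fact p.Prime] [CharP k p] (m : ℕ) (a b : A) :
    ((LinearMap.mulLeft k a - LinearMap.mulRight k a) ^ p ^ m) b = a ^ p ^ m * b - b * a ^ p ^ m := by
  have : CharP (Module.End k A) p := charP_of_injective_algebraMap (algebraMap k _).injective p
  rw [sub_pow_char_pow_of_commute _ _ (LinearMap.commute_mulLeft_right a a), LinearMap.sub_apply,
    LinearMap.pow_mulLeft, LinearMap.mulLeft_apply, LinearMap.pow_mulRight,
    LinearMap.mulRight_apply]

/-- All terms are polynomials in `a`, so the identity comes from Frobenius in the commutative ring
`k[X]`. -/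
theorem sum_smul_pow_char_pow_pow {k A : Type*} [Field k] [Ring A] [Algebra k A] (p : ℕ)
    [Fact p.Prime] [CharP k p] (m : ℕ) (a : A) (s : Finset ℕ) (c : ℕ → k) :
    (∑ i ∈ s, c i • a ^ p ^ i) ^ p ^ m = ∑ i ∈ s, c i ^ p ^ m • a ^ p ^ (i + m) := by
  have h : ∀ (N : ℕ → ℕ) (c : ℕ → k), ∑ i ∈ s, c i • a ^ N i =
      Polynomial.aeval a (∑ i ∈ s, c i • (Polynomial.X : Polynomial k) ^ N i) := fun N c => by
    simp [map_sum]
  rw [h, h, ← map_pow, sum_pow_char_pow]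
  simp only [smul_pow, ← pow_mul, pow_add]

-- Shortcuts that speed up the instance search.
local instance : CommRing (O k p n) := inferInstance
local instance : AddCommGroup (O k p n) := inferInstance
local instance : Module k (O k p n) := inferInstance
local instance : Ring (Module.End k (O k p n)) := inferInstance
local instance : Module k (Module.End k (O k p n)) := inferInstance
local instance : AddCommGroup (W k p n) := inferInstance
local instance : Module k (W k p n) := inferInstance
local instance : Ring (Module.End k (W k p n)) := inferInstance
local instance : Module k (Module.End k (W k p n)) := inferInstance

theorem coe_add_apply (v w : W k p n) (f : O k p n) : (v + w).1 f = v.1 f + w.1 f := rfl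

theorem coe_sub_apply (v w : W k p n) (f : O k p n) : (v - w).1 f = v.1 f - w.1 f := rfl

theorem coe_smul_apply (r : k) (w : W k p n) (f : O k p n) : (r • w).1 f = r • w.1 f := rfl

variable (k p n) in
/-- The pairs of a derivation `D` of `O(1;n)` that normalizes `W(1;n)`, and the endomorphism
`ad D` of `W(1;n)`. -/
def normalizerPairs : Submodule k (Module.End k (O k p n) × Module.End k (W k p n)) where
  carrier := {DE | (∀ f g, DE.1 (f * g) = DE.1 f * g + f * DE.1 g) ∧
    ∀ (w : W k p n) (f : O k p n), (DE.2 w).1 f = DE.1 (w.1 f) - w.1 (DE.1 f)}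
  add_mem' := by
    rintro ⟨D, E⟩ ⟨D', E'⟩ ⟨h1, h2⟩ ⟨h1', h2'⟩
    refine ⟨fun f g => ?_, fun w f => ?_⟩
    · have e1 := h1 f g
      have e2 := h1' f g
      simp only at e1 e2
      simp only [Prod.fst_add, LinearMap.add_apply, e1, e2]
      ring
    · have e1 := h2 w f
      have e2 := h2' w f
      simp only at e1 e2
      simp only [Prod.fst_add, Prod.snd_add, LinearMap.add_apply, map_add]
      rw [coe_add_apply, e1, e2]
      ring
  zero_mem' := ⟨fun f g => by simp, fun w f => by simp⟩
  smul_mem' := by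
    rintro r ⟨D, E⟩ ⟨h1, h2⟩
    refine ⟨fun f g => ?_, fun w f => ?_⟩
    · have e1 := h1 f g
      simp only at e1
      simp [e1]
    · have e1 := h2 w f
      simp only at e1
      simp only [Prod.smul_fst, Prod.smul_snd, LinearMap.smul_apply]
      rw [coe_smul_apply, e1, smul_sub, Derivation.map_smul]

section

variable {D D' : Module.End k (O k p n)} {E E' : Module.End k (W k p n)}

theorem normalizerPairs_leibniz (h : (D, E) ∈ normalizerPairs k p n) (f g : O k p n) :
    D (f * g) = D f * g + f * D g := h.1 f g

theorem normalizerPairs_apply (h : (D, E) ∈ normalizerPairs k p n) (w : W k p n) (f : O k p n) :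
    (E w).1 f = D (w.1 f) - w.1 (D f) := h.2 w f

theorem normalizerPairs_one (h : (D, E) ∈ normalizerPairs k p n) : D 1 = 0 := by
  have := normalizerPairs_leibniz h 1 1
  simpa using this

theorem ad_mem_normalizerPairs (w : W k p n) :
    ((w.1 : O k p n →ₗ[k] O k p n), LieAlgebra.ad k (W k p n) w) ∈ normalizerPairs k p n := by
  refine ⟨fun f g => ?_, fun v f => ?_⟩
  · change w.1 (f * g) = w.1 f * g + f * w.1 g
    rw [Derivation.leibniz, smul_eq_mul, smul_eq_mul]
    ring
  · change (⁅w.1, v.1⁆ : Derivation k (O k p n) (O k p n)) f = _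
    rw [Derivation.commutator_apply]
    rfl

theorem lie_mem_normalizerPairs (h : (D, E) ∈ normalizerPairs k p n)
    (h' : (D', E') ∈ normalizerPairs k p n) :
    (⁅D, D'⁆, ⁅E, E'⁆) ∈ normalizerPairs k p n := by
  refine ⟨fun f g => ?_, fun w f => ?_⟩
  · simp only [LieRing.of_associative_ring_bracket, LinearMap.sub_apply, Module.End.mul_apply,
      normalizerPairs_leibniz h, normalizerPairs_leibniz h', map_add]
    ring
  · simp only [LieRing.of_associative_ring_bracket, LinearMap.sub_apply, Module.End.mul_apply]
    rw [coe_sub_apply, normalizerPairs_apply h,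
      normalizerPairs_apply h', normalizerPairs_apply h', normalizerPairs_apply h',
      normalizerPairs_apply h, normalizerPairs_apply h]
    simp only [map_sub]
    abel

theorem pow_mem_normalizerPairs (h : (D, E) ∈ normalizerPairs k p n) (m : ℕ) :
    (D ^ p ^ m, E ^ p ^ m) ∈ normalizerPairs k p n := by
  refine ⟨fun f g => ?_, fun w f => ?_⟩
  -- The Leibniz rule says `[D, mult f] = mult (D f)`. Iterating it `p^m` times and using `(ad
  -- D)^(p^m) = ad (D^(p^m))` gives the rule for `D^(p^m)`; the same argument with `w` in place of
  -- `mult f` handles `E`.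
  · have h1 : ∀ j : ℕ, ((LinearMap.mulLeft k D - LinearMap.mulRight k D) ^ j)
        (LinearMap.mulLeft k f) = LinearMap.mulLeft k ((D ^ j) f) := fun j => by
      induction j with
      | zero => rfl
      | succ j ih =>
        rw [pow_succ', Module.End.mul_apply, ih, pow_succ', Module.End.mul_apply]
        ext1 g
        simp only [LinearMap.sub_apply, LinearMap.mulLeft_apply, LinearMap.mulRight_apply,
          Module.End.mul_apply]
        rw [normalizerPairs_leibniz h]
        ring
    have h2 := LinearMap.congr_fun (h1 (p ^ m)) g
    rw [ad_pow_char_pow p] at h2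
    simp only [LinearMap.sub_apply, LinearMap.mulLeft_apply, Module.End.mul_apply] at h2
    simp only
    rw [← h2]; ring
  · have h1 : ∀ j : ℕ, ((LinearMap.mulLeft k D - LinearMap.mulRight k D) ^ j)
        (w.1 : O k p n →ₗ[k] O k p n) = (((E ^ j) w).1 : O k p n →ₗ[k] O k p n) := fun j => by
      induction j with
      | zero => rfl
      | succ j ih =>
        rw [pow_succ', Module.End.mul_apply, ih, pow_succ', Module.End.mul_apply]
        ext1 g
        exact (normalizerPairs_apply h _ g).symm
    have h2 := LinearMap.congr_fun (h1 (p ^ m)) f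
    rw [ad_pow_char_pow p] at h2
    exact h2.symm

end

/-- The second components of the pairs form a Lie algebra that contains `ad W(1;n)` and is closed
under `p`-th powers, and `Wp` is the smallest such. -/
theorem exists_normalizerPairs_of_mem_Wp {E : Module.End k (W k p n)} (hE : E ∈ Wp k p n) :
    ∃ D, (D, E) ∈ normalizerPairs k p n := by
  let S : LieSubalgebra k (Module.End k (W k p n)) :=
    { (normalizerPairs k p n).map (LinearMap.snd k _ _) with
      lie_mem' := by
        rintro _ _ ⟨⟨D, E⟩, h, rfl⟩ ⟨⟨D', E'⟩, h', rfl⟩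
        exact ⟨_, lie_mem_normalizerPairs h h', rfl⟩ }
  have hS : Wp k p n ≤ S := by
    refine sInf_le ⟨?_, ?_⟩
    · rintro _ ⟨w, rfl⟩
      exact ⟨_, ad_mem_normalizerPairs w, rfl⟩
    · rintro _ ⟨⟨D, E⟩, h, rfl⟩
      have := pow_mem_normalizerPairs h 1
      rw [pow_one] at this
      exact ⟨_, this, rfl⟩
  obtain ⟨⟨D, E⟩, h, rfl⟩ := hS hE
  exact ⟨D, h⟩

theorem coe_mulDel_apply (g f : O k p n) : (mulDel k p n g).1 f = g * del k p n f := rfl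

theorem eq_mulDel (w : W k p n) : w = mulDel k p n (w.1 (X k p n 1)) := by
  apply Subtype.ext
  apply Derivation.ext
  intro f
  exact special_apply w.2 f

/-- The action of the normalizer of `W(1;n)` is faithful. -/
theorem eq_zero_of_normalizerPairs (hn : n ≠ 0) {D : Module.End k (O k p n)}
    (h : (D, 0) ∈ normalizerPairs k p n) : D = 0 := by
  ext1 f
  have hX : del k p n (X k p n 1) = 1 := by
    rw [← X_zero]
    exact del_X (a := 0) (Nat.one_lt_pow hn (Fact.out : p.Prime).one_lt)
  -- Evaluating `[D, f∂] = 0` at `x` gives `D f = f ∂(D x)`; the case `f = 1` gives `∂(D x) = 0`.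
  have h1 := normalizerPairs_apply h (mulDel k p n f) (X k p n 1)
  have h2 := normalizerPairs_apply h (mulDel k p n 1) (X k p n 1)
  rw [coe_mulDel_apply, coe_mulDel_apply, hX, mul_one] at h1
  rw [coe_mulDel_apply, coe_mulDel_apply, hX, mul_one, one_mul, normalizerPairs_one h, zero_sub]
    at h2
  have h3 : del k p n (D (X k p n 1)) = 0 := neg_eq_zero.1 h2.symm
  rw [h3, mul_zero, sub_zero] at h1
  exact h1.symm

/-! ### The centralizer of `∂`, and a criterion for lying in `W_(0)`. -/

theorem exists_not_dvd_choose {p : ℕ} [hp : Fact p.Prime] {a : ℕ} (ha : 0 < a)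
    (h : ∀ i, a ≠ p ^ i) : ∃ b, 0 < b ∧ b < a ∧ ¬ p ∣ a.choose b := by
  by_contra! hc
  refine h _ (Choose.eq_pow_multiplicity_of_choose_modEq_zero_nat (p := p) ha fun i hi => ?_)
  rw [Finset.mem_Icc] at hi
  exact (Nat.modEq_zero_iff_dvd).2 (hc i (by omega) (by omega))

theorem end_ext_X {D D' : Module.End k (O k p n)}
    (h : ∀ a < p ^ n, D (X k p n a) = D' (X k p n a)) : D = D' := by
  ext1 f
  rw [eq_sum_X f]
  simp only [map_sum, LinearMap.map_smul]
  exact Finset.sum_congr rfl fun a ha => by rw [h a (Finset.mem_range.1 ha)]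

/-- A derivation of `O(1;n)` that commutes with `∂` is determined by the constant terms of its
values at the `x^(p^i)`. -/
theorem eq_zero_of_commute_del {D : Module.End k (O k p n)}
    (hD : ∀ f g, D (f * g) = D f * g + f * D g)
    (hc : ∀ f, D (del k p n f) = del k p n (D f))
    (h0 : ∀ i < n, (D (X k p n (p ^ i)) : DPSeries k) 0 = 0) : D = 0 := by
  have hp : p.Prime := Fact.out
  refine end_ext_X fun a => ?_
  induction a using Nat.strong_induction_on with
  | _ a ih =>
    intro ha
    rw [LinearMap.zero_apply]
    rcases Nat.eq_zero_or_pos a with rfl | hpos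
    · have := hD 1 1
      rw [X_zero]
      simpa using this
    -- If `a` is not a power of `p`, then `x^(a)` is a scalar multiple of some product `x^(b)
    -- x^(a-b)` with `0 < b < a`. If it is, `∂ D x^(a) = D x^(a-1) = 0`, so `D x^(a)` is constant
    -- and `h0` applies.
    by_cases hpow : ∀ i, a ≠ p ^ i
    · obtain ⟨b, hb0, hba, hdvd⟩ := exists_not_dvd_choose (p := p) hpos hpow
      have hu : (a.choose b : k) ≠ 0 := fun h => hdvd ((CharP.cast_eq_zero_iff k p _).1 h)
      have e := X_mul_X (k := k) (p := p) (n := n) (a := b) (b := a - b) (by omega) (by omega)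
      rw [Nat.add_sub_cancel' hba.le] at e
      have e2 := congrArg D e
      rw [hD, ih b hba (by omega), ih (a - b) (by omega) (by omega), LinearMap.zero_apply,
        LinearMap.zero_apply, zero_mul, mul_zero, add_zero, LinearMap.map_smul] at e2
      exact (smul_eq_zero.1 e2.symm).resolve_left hu
    · push Not at hpow
      obtain ⟨i, rfl⟩ := hpow
      have hin : i < n := (Nat.pow_lt_pow_iff_right hp.one_lt).1 ha
      obtain ⟨b, hb⟩ := Nat.exists_eq_succ_of_ne_zero hpos.ne'
      have e := hc (X k p n (p ^ i))
      rw [hb, del_X (by omega), ih b (by omega) (by omega), ← hb, LinearMap.zero_apply] at e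
      exact Subtype.ext (eq_of_deriv (h0 i hin) (congrArg Subtype.val e).symm)

theorem delEnd_pow_apply_X (m a : ℕ) (ha : a < p ^ n) :
    ((delEnd k p n ^ m) (X k p n a) : DPSeries k) 0 = if m = a then 1 else 0 := by
  rw [coe_delEnd_pow_apply, coe_X ha, x_apply, zero_add]

theorem delPow_mem_normalizerPairs (i : ℕ) :
    (delEnd k p n ^ p ^ i, delPow k p n i) ∈ normalizerPairs k p n := by
  have h := ad_mem_normalizerPairs (mulDel k p n 1)
  have e : ((mulDel k p n 1).1 : O k p n →ₗ[k] O k p n) = delEnd k p n :=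
    LinearMap.ext fun f => one_mul _
  rw [e] at h
  exact pow_mem_normalizerPairs h i

theorem delPow_eq_zero {i : ℕ} (hi : n ≤ i) : delPow k p n i = 0 := by
  have h := delPow_mem_normalizerPairs (k := k) (p := p) (n := n) i
  rw [delEnd_pow_eq_zero (Nat.pow_le_pow_right (Fact.out : p.Prime).pos hi)] at h
  ext1 w
  apply Subtype.ext
  apply Derivation.ext
  intro f
  rw [normalizerPairs_apply h]
  simp

theorem eq_of_mem_normalizerPairs {D : Module.End k (O k p n)} {E E' : Module.End k (W k p n)}
    (h : (D, E) ∈ normalizerPairs k p n) (h' : (D, E') ∈ normalizerPairs k p n) : E = E' := by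
  ext1 w
  apply Subtype.ext
  apply Derivation.ext
  intro f
  rw [normalizerPairs_apply h, normalizerPairs_apply h']

theorem sum_mem_normalizerPairs {D : ℕ → Module.End k (O k p n)} {E : ℕ → Module.End k (W k p n)}
    (h : ∀ i, (D i, E i) ∈ normalizerPairs k p n) (s : Finset ℕ) (c : ℕ → k) :
    (∑ i ∈ s, c i • D i, ∑ i ∈ s, c i • E i) ∈ normalizerPairs k p n := by
  have := (normalizerPairs k p n).sum_mem (t := s) (f := fun i => c i • (D i, E i))
    fun i _ => (normalizerPairs k p n).smul_mem _ (h i)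
  convert this using 1
  ext1
  · simp [Prod.fst_sum]
  · simp [Prod.snd_sum]

theorem coe_sum_smul_apply (s : Finset ℕ) (c : ℕ → k) (f : ℕ → O k p n) (a : ℕ) :
    ((∑ i ∈ s, c i • f i : O k p n) : DPSeries k) a = ∑ i ∈ s, c i * (f i : DPSeries k) a := by
  induction s using Finset.cons_induction with
  | empty => rfl
  | cons b s hb ih =>
    rw [Finset.sum_cons, Finset.sum_cons, ← ih]
    rfl

/-- The centralizer of `∂` in the normalizer of `W(1;n)` is spanned by the `∂^(p^i)`. -/
theorem eq_sum_delPow {D : Module.End k (O k p n)} {E : Module.End k (W k p n)}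
    (h : (D, E) ∈ normalizerPairs k p n) (hE : E (mulDel k p n 1) = 0) :
    ∃ c : ℕ → k, E = ∑ i ∈ Finset.range n, c i • delPow k p n i := by
  -- The constant term of `∂^(p^j) x^(p^i)` is `1` if `i = j` and `0` otherwise, so the coefficients
  -- can be read off from `D`.
  refine ⟨fun i => (D (X k p n (p ^ i)) : DPSeries k) 0, ?_⟩
  set c : ℕ → k := fun i => (D (X k p n (p ^ i)) : DPSeries k) 0 with hc
  have hs := sum_mem_normalizerPairs (delPow_mem_normalizerPairs (k := k) (p := p) (n := n))
    (Finset.range n) c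
  have hcomm : ∀ f, D (del k p n f) = del k p n (D f) := fun f => by
    have h1 := normalizerPairs_apply h (mulDel k p n 1) f
    rw [hE, coe_mulDel_apply, coe_mulDel_apply, one_mul, one_mul] at h1
    exact (sub_eq_zero.1 h1.symm)
  have hD : D - ∑ i ∈ Finset.range n, c i • delEnd k p n ^ p ^ i = 0 := by
    have hm := (normalizerPairs k p n).sub_mem h hs
    refine eq_zero_of_commute_del (fun f g => normalizerPairs_leibniz hm f g) (fun f => ?_)
      fun i hi => ?_
    · have e : ∀ m, (delEnd k p n ^ m) (del k p n f) = del k p n ((delEnd k p n ^ m) f) := fun m => by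
        rw [← delEnd_apply, ← delEnd_apply, ← Module.End.mul_apply, ← Module.End.mul_apply,
          ← pow_succ, ← pow_succ']
      simp only [LinearMap.sub_apply, LinearMap.sum_apply, LinearMap.smul_apply, map_sub, map_sum,
        Derivation.map_smul, hcomm, e]
    · have hi' : p ^ i < p ^ n := Nat.pow_lt_pow_right (Fact.out : p.Prime).one_lt hi
      simp only [LinearMap.sub_apply, LinearMap.sum_apply, LinearMap.smul_apply]
      rw [AddSubgroupClass.coe_sub, sub_eq_add_neg, DPSeries.add_apply, ← neg_one_smul k,
        DPSeries.smul_apply, coe_sum_smul_apply]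
      simp only [delEnd_pow_apply_X _ _ hi',
        (Nat.pow_right_injective (Fact.out : p.Prime).two_le).eq_iff]
      simp [hi, hc]
  rw [sub_eq_zero] at hD
  rw [hD] at h
  exact eq_of_mem_normalizerPairs h hs

/-- An element of the normalizer of `W(1;n)` such that all its values at the `x^(p^i)` have
constant term zero lies in `W(1;n)_(0)`. -/
theorem exists_eq_ad_mulDel (hn : n ≠ 0) {D : Module.End k (O k p n)} {E : Module.End k (W k p n)}
    (h : (D, E) ∈ normalizerPairs k p n)
    (h0 : ∀ i < n, (D (X k p n (p ^ i)) : DPSeries k) 0 = 0) :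
    ∃ f : O k p n, (f : DPSeries k) 0 = 0 ∧ D = ((mulDel k p n f).1 : O k p n →ₗ[k] O k p n) ∧
      E = LieAlgebra.ad k (W k p n) (mulDel k p n f) := by
  have hp : p.Prime := Fact.out
  have hpn : 1 < p ^ n := Nat.one_lt_pow hn hp.one_lt
  obtain ⟨g, hg⟩ : ∃ g, E (mulDel k p n 1) = mulDel k p n g := ⟨_, eq_mulDel _⟩
  have hcomm : ∀ f, D (del k p n f) - del k p n (D f) = g * del k p n f := fun f => by
    have h1 := normalizerPairs_apply h (mulDel k p n 1) f
    rw [hg, coe_mulDel_apply, coe_mulDel_apply, coe_mulDel_apply, one_mul, one_mul] at h1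
    exact h1.symm
  have hX : del k p n (X k p n 1) = 1 := by
    rw [← X_zero]
    exact del_X (a := 0) hpn
  -- Here `[D, ∂] = g∂`. The top coefficient of `g` obstructs integrating it inside `O(1;n)`. It
  -- vanishes because `(ad ∂)^(p^n) = ad (∂^(p^n)) = 0`, while `(ad ∂)^(p^n) D = -(∂^(p^n-1) g)∂`.
  have htop : (g : DPSeries k) (p ^ n - 1) = 0 := by
    have h1 : ∀ j : ℕ, ∀ f, ((LinearMap.mulLeft k (delEnd k p n) -
        LinearMap.mulRight k (delEnd k p n)) ^ (j + 1)) D f =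
          -((delEnd k p n ^ j) g * del k p n f) := fun j => by
      induction j with
      | zero =>
        intro f
        rw [zero_add, pow_one, pow_zero, Module.End.one_apply, ← hcomm]
        exact (neg_sub _ _).symm
      | succ j ih =>
        intro f
        rw [pow_succ', Module.End.mul_apply, LinearMap.sub_apply, LinearMap.sub_apply,
          LinearMap.mulLeft_apply, LinearMap.mulRight_apply, Module.End.mul_apply,
          Module.End.mul_apply, ih, ih, pow_succ', Module.End.mul_apply, delEnd_apply, delEnd_apply,
          delEnd_apply, map_neg, Derivation.leibniz, smul_eq_mul, smul_eq_mul]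
        ring
    have h2 := h1 (p ^ n - 1) (X k p n 1)
    rw [Nat.sub_add_cancel hpn.le, ad_pow_char_pow p, delEnd_pow_eq_zero le_rfl, zero_mul, mul_zero,
      sub_zero, LinearMap.zero_apply, hX, mul_one] at h2
    have h3 := DFunLike.congr_fun (congrArg Subtype.val (neg_eq_zero.1 h2.symm)) 0
    rwa [coe_delEnd_pow_apply, zero_add] at h3
  let H : O k p n := ⟨integ g, fun a ha => by
    rcases a with _ | a
    · rfl
    · change (g : DPSeries k) a = 0
      rcases Nat.lt_or_ge a (p ^ n) with h' | h'
      · rwa [show a = p ^ n - 1 by omega]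
      · exact g.2 a h'⟩
  have hH : del k p n H = g := Subtype.ext (deriv_integ _)
  have hm := (normalizerPairs k p n).add_mem h (ad_mem_normalizerPairs (mulDel k p n H))
  -- Since `[H∂, ∂] = -g∂`, the sum commutes with `∂`; its constant terms at the `x^(p^i)` vanish
  -- since `H` has none.
  have hD : D + ((mulDel k p n H).1 : O k p n →ₗ[k] O k p n) = 0 := by
    refine eq_zero_of_commute_del (fun f g => normalizerPairs_leibniz hm f g) (fun f => ?_)
      fun i hi => ?_
    · change D (del k p n f) + H * del k p n (del k p n f) = del k p n (D f + H * del k p n f)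
      rw [map_add, Derivation.leibniz, hH, smul_eq_mul, smul_eq_mul]
      linear_combination hcomm f
    · change (D (X k p n (p ^ i)) : DPSeries k) 0 +
        ((H : DPSeries k) * (del k p n (X k p n (p ^ i)) : DPSeries k)) 0 = 0
      rw [h0 i hi, mul_apply_zero, zero_add]
      exact zero_mul _
  have hneg : ((mulDel k p n (-H)).1 : O k p n →ₗ[k] O k p n) = D := by
    rw [eq_neg_of_add_eq_zero_left hD]
    refine LinearMap.ext fun f => ?_
    change -H * del k p n f = -(H * del k p n f)
    rw [neg_mul]
  refine ⟨-H, ?_, hneg.symm, ?_⟩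
  · exact neg_zero
  · have h2 := ad_mem_normalizerPairs (mulDel k p n (-H))
    rw [hneg] at h2
    exact eq_of_mem_normalizerPairs h h2

/-! ### Conjugating nilpotent derivations `g∂` to `∂`. -/

/-- `T` maps `ker T^(j+1)` into `ker T^j`, with kernel inside `ker T`. -/
theorem finrank_ker_pow_le {k V : Type*} [Field k] [AddCommGroup V] [Module k V]
    [FiniteDimensional k V] (T : Module.End k V) (h : Module.finrank k (LinearMap.ker T) ≤ 1)
    (j : ℕ) : Module.finrank k (LinearMap.ker (T ^ j)) ≤ j := by
  induction j with
  | zero =>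
    have : LinearMap.ker (T ^ 0) = ⊥ := LinearMap.ker_eq_bot.2 fun _ _ h => h
    rw [this, finrank_bot]
  | succ j ih =>
    have h1 := (T.domRestrict (LinearMap.ker (T ^ (j + 1)))).finrank_range_add_finrank_ker
    have h2 : LinearMap.range (T.domRestrict (LinearMap.ker (T ^ (j + 1)))) ≤
        LinearMap.ker (T ^ j) := by
      rintro _ ⟨⟨v, hv⟩, rfl⟩
      rwa [LinearMap.mem_ker, pow_succ, Module.End.mul_apply] at hv
    have h3 : (LinearMap.ker (T.domRestrict (LinearMap.ker (T ^ (j + 1))))).map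
        (LinearMap.ker (T ^ (j + 1))).subtype ≤ LinearMap.ker T := by
      rintro _ ⟨v, hv, rfl⟩
      exact hv
    have h4 := Submodule.finrank_mono h2
    have h5 := Submodule.finrank_mono h3
    rw [Submodule.finrank_map_subtype_eq] at h5
    omega

theorem ker_mulDel_finrank_le {g : O k p n} (hg : IsUnit g) :
    Module.finrank k (LinearMap.ker ((mulDel k p n g).1 : O k p n →ₗ[k] O k p n)) ≤ 1 := by
  have h : LinearMap.ker ((mulDel k p n g).1 : O k p n →ₗ[k] O k p n) ≤
      Submodule.span k {(1 : O k p n)} := by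
    intro f hf
    have hf' : del k p n f = 0 := hg.mul_right_eq_zero.1 hf
    refine Submodule.mem_span_singleton.2 ⟨(f : DPSeries k) 0, Subtype.ext (eq_of_deriv ?_ ?_)⟩
    · change (f : DPSeries k) 0 * (1 : DPSeries k) 0 = _
      simp [one_apply]
    · rw [← coe_del, ← coe_del, hf', Derivation.map_smul, Derivation.map_one_eq_zero, smul_zero]
  exact (Submodule.finrank_mono h).trans (by
    simpa using finrank_span_le_card (R := k) ({(1 : O k p n)} : Set (O k p n)))

/-- A nilpotent derivation `g∂` with `g` invertible is conjugate to `∂`. -/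
theorem exists_conjW_eq_mulDel {g : O k p n} (hg : (g : DPSeries k) 0 ≠ 0)
    (hnil : ((mulDel k p n g).1 : O k p n →ₗ[k] O k p n) ^ p ^ n = 0) :
    ∃ Φ : G k p n, conjW Φ (mulDel k p n 1) = mulDel k p n g := by
  have hpos : 0 < p ^ n := pow_pos (Fact.out : p.Prime).pos n
  have hgu := isUnit_of_coe_apply_zero_ne_zero hg
  set T : Module.End k (O k p n) := ((mulDel k p n g).1 : O k p n →ₗ[k] O k p n) with hT
  have hTa : ∀ f, T f = g * del k p n f := fun f => rfl
  -- `T` is a single Jordan block: the range has dimension at least `p^n - 1`, and the kernel of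
  -- `T^(p^n-1)` at most that.
  have hker : LinearMap.ker (T ^ (p ^ n - 1)) = LinearMap.range T := by
    refine (Submodule.eq_of_le_of_finrank_le ?_ ?_).symm
    · rintro _ ⟨f, rfl⟩
      rw [LinearMap.mem_ker, ← Module.End.mul_apply, ← pow_succ, Nat.sub_add_cancel hpos, hnil,
        LinearMap.zero_apply]
    · have h1 := finrank_ker_pow_le T (ker_mulDel_finrank_le hgu) (p ^ n - 1)
      have h2 := T.finrank_range_add_finrank_ker
      have h3 : Module.finrank k (LinearMap.ker T) ≤ 1 := ker_mulDel_finrank_le hgu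
      rw [finrank_O] at h2
      omega
  obtain ⟨u, hu⟩ := hgu.exists_right_inv
  have hu' : (g : DPSeries k) * u = 1 := congrArg Subtype.val hu
  -- With `y' = g⁻¹`, the operator `g∂` sends `y^(a+1)` to `y^(a)`, just as `∂` does for `x`.
  set y : DPSeries k := integ u with hy
  have hdy : DPSeries.deriv y = u := deriv_integ _
  have hmem : ∀ a < p ^ n, ∃ h : dpowAux y a ∈ O k p n, (T ^ (a + 1)) ⟨dpowAux y a, h⟩ = 0 := by
    intro a
    induction a with
    | zero =>
      intro _
      refine ⟨(O k p n).one_mem, ?_⟩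
      rw [zero_add, pow_one, hTa]
      exact (congrArg (g * ·) (Derivation.map_one_eq_zero _)).trans (mul_zero _)
    | succ a ih =>
      intro ha
      obtain ⟨h, h0⟩ := ih (by omega)
      -- For `a + 1 < p^n`, the power `y^(a)` is killed by `T^(p^n-1)`, so it is `T f` for some `f`
      -- in `O(1;n)`. Then `y^(a+1)` and `f` have the same derivative, which puts `y^(a+1)` in
      -- `O(1;n)`.
      have hz : (⟨dpowAux y a, h⟩ : O k p n) ∈ LinearMap.range T := by
        rw [← hker, LinearMap.mem_ker, show p ^ n - 1 = p ^ n - 1 - (a + 1) + (a + 1) by omega,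
          pow_add, Module.End.mul_apply, h0, map_zero]
      obtain ⟨f, hf⟩ := hz
      have hf' : (g : DPSeries k) * DPSeries.deriv (f : DPSeries k) = dpowAux y a :=
        congrArg Subtype.val hf
      have hdf : DPSeries.deriv (dpowAux y (a + 1)) = DPSeries.deriv (f : DPSeries k) := by
        rw [deriv_dpowAux, ← hf', hdy]
        linear_combination (DPSeries.deriv (f : DPSeries k)) * hu'
      have hO : dpowAux y (a + 1) ∈ O k p n := by
        intro c hc
        obtain ⟨c, rfl⟩ := Nat.exists_eq_succ_of_ne_zero (by omega : c ≠ 0)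
        exact (DFunLike.congr_fun hdf c).trans (f.2 _ hc)
      refine ⟨hO, ?_⟩
      have hTz : T ⟨dpowAux y (a + 1), hO⟩ = ⟨dpowAux y a, h⟩ := by
        apply Subtype.ext
        change (g : DPSeries k) * DPSeries.deriv (dpowAux y (a + 1)) = dpowAux y a
        rw [hdf, hf']
      rw [pow_succ, Module.End.mul_apply, hTz, h0]
  exact ⟨substG y (fun a ha => (hmem a ha).1) (hdy ▸ IsUnit.of_mul_eq_one_right _ hu'),
    conj_substG _ _ (hdy ▸ hu')⟩

/-! ### The action of `G` on endomorphisms of `W(1;n)`. -/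

theorem act_apply (Φ : G k p n) (E : Module.End k (W k p n)) (w : W k p n) :
    act Φ E w = conjW Φ (E (conjW Φ⁻¹ w)) := rfl

theorem conjW_apply_apply (Φ : G k p n) (w : W k p n) (f : O k p n) :
    (conjW Φ w).1 f = Φ.1 (w.1 (Φ.1.symm f)) := rfl

theorem conjW_inv_apply_conjW (Φ : G k p n) (w : W k p n) : conjW Φ⁻¹ (conjW Φ w) = w :=
  (conjW Φ).left_inv w

theorem conjW_apply_conjW_inv (Φ : G k p n) (w : W k p n) : conjW Φ (conjW Φ⁻¹ w) = w :=
  (conjW Φ).right_inv w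

theorem act_mul (Φ Ψ : G k p n) (E : Module.End k (W k p n)) :
    act (Φ * Ψ) E = act Φ (act Ψ E) := rfl

theorem act_inv_act (Φ : G k p n) (E : Module.End k (W k p n)) : act Φ⁻¹ (act Φ E) = E := by
  ext1 w
  have := act_apply Φ⁻¹ (act Φ E) w
  rw [inv_inv] at this
  rw [this, act_apply, conjW_inv_apply_conjW, conjW_inv_apply_conjW]

theorem act_act_inv (Φ : G k p n) (E : Module.End k (W k p n)) : act Φ (act Φ⁻¹ E) = E := by
  have := act_inv_act Φ⁻¹ E
  rwa [inv_inv] at this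

theorem act_pow (Φ : G k p n) (E : Module.End k (W k p n)) (m : ℕ) :
    act Φ (E ^ m) = act Φ E ^ m :=
  map_pow ((conjW Φ).toLinearEquiv.conjAlgEquiv k) E m

theorem act_sum_smul (Φ : G k p n) (s : Finset ℕ) (c : ℕ → k) (E : ℕ → Module.End k (W k p n)) :
    act Φ (∑ i ∈ s, c i • E i) = ∑ i ∈ s, c i • act Φ (E i) := by
  induction s using Finset.cons_induction with
  | empty => exact LinearEquiv.map_zero _
  | cons a s ha ih =>
    rw [Finset.sum_cons, Finset.sum_cons, ← ih]
    exact (LinearEquiv.map_add _ _ _).trans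
      (congrArg (· + _) (LinearEquiv.map_smul _ _ _))

theorem act_ad (Φ : G k p n) (w : W k p n) :
    act Φ (LieAlgebra.ad k (W k p n) w) = LieAlgebra.ad k (W k p n) (conjW Φ w) := by
  ext1 v
  rw [act_apply, LieAlgebra.ad_apply, LieAlgebra.ad_apply, LieEquiv.map_lie, conjW_apply_conjW_inv]

theorem act_mem_normalizerPairs (Φ : G k p n) {D : Module.End k (O k p n)}
    {E : Module.End k (W k p n)} (h : (D, E) ∈ normalizerPairs k p n) :
    (Φ.1.toLinearMap ∘ₗ D ∘ₗ Φ.1.symm.toLinearMap, act Φ E) ∈ normalizerPairs k p n := by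
  refine ⟨fun f g => ?_, fun w f => ?_⟩
  · simp [normalizerPairs_leibniz h]
  · change Φ.1 ((E (conjW Φ⁻¹ w)).1 (Φ.1.symm f)) = _
    rw [normalizerPairs_apply h]
    change Φ.1 (D (Φ.1.symm (w.1 (Φ.1 (Φ.1.symm f)))) - Φ.1.symm (w.1 (Φ.1 (D (Φ.1.symm f))))) =
      Φ.1 (D (Φ.1.symm (w.1 f))) - w.1 (Φ.1 (D (Φ.1.symm f)))
    rw [AlgEquiv.apply_symm_apply, map_sub, AlgEquiv.apply_symm_apply]

/-! ### Conjugates of combinations of the `∂^(p^i)` are regular nilpotent. -/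

variable (k p n) in
/-- The linear map `f ↦ f∂`. -/
def mulDelLinear : O k p n →ₗ[k] W k p n where
  toFun := mulDel k p n
  map_add' f g := Subtype.ext (add_smul f g (del k p n))
  map_smul' r f := Subtype.ext (smul_assoc r f (del k p n))

theorem mulDel_smul (r : k) (f : O k p n) : mulDel k p n (r • f) = r • mulDel k p n f :=
  (mulDelLinear k p n).map_smul r f

theorem ad_mulDel_mem_adW0 {f : O k p n} (hf : (f : DPSeries k) 0 = 0) :
    LieAlgebra.ad k (W k p n) (mulDel k p n f) ∈ adW0 k p n := by
  have e : LieAlgebra.ad k (W k p n) (mulDel k p n f) = ∑ a ∈ Finset.range (p ^ n),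
      (f : DPSeries k) a • LieAlgebra.ad k (W k p n) (mulDel k p n (X k p n a)) := by
    conv_lhs => rw [eq_sum_X f]
    change ((LieAlgebra.ad k (W k p n)).toLinearMap ∘ₗ mulDelLinear k p n) _ = _
    rw [map_sum]
    exact Finset.sum_congr rfl fun a _ => LinearMap.map_smul _ _ _
  rw [e]
  refine Submodule.sum_mem _ fun a ha => ?_
  rcases Nat.eq_zero_or_pos a with rfl | hpos
  · rw [hf, zero_smul]
    exact Submodule.zero_mem _
  · have := Finset.mem_range.1 ha
    exact Submodule.smul_mem _ _ (Submodule.subset_span ⟨a, hpos, by omega, rfl⟩)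

theorem sum_smul_delPow_pow (c : ℕ → k) (s : Finset ℕ) (m : ℕ) :
    (∑ i ∈ s, c i • delPow k p n i) ^ p ^ m = ∑ i ∈ s, c i ^ p ^ m • delPow k p n (i + m) :=
  sum_smul_pow_char_pow_pow p m _ s c

theorem sum_smul_delPow_pow_eq_zero (c : ℕ → k) (s : Finset ℕ) {m : ℕ} (hm : n ≤ m) :
    (∑ i ∈ s, c i • delPow k p n i) ^ p ^ m = 0 := by
  rw [sum_smul_delPow_pow]
  exact Finset.sum_eq_zero fun i _ => by rw [delPow_eq_zero (by omega), smul_zero]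

theorem sum_smul_delPow_pow_pred (hn : n ≠ 0) (c : ℕ → k) :
    (∑ i ∈ Finset.range n, c i • delPow k p n i) ^ p ^ (n - 1) =
      c 0 ^ p ^ (n - 1) • delPow k p n (n - 1) := by
  rw [sum_smul_delPow_pow, Finset.sum_eq_single 0]
  · rw [zero_add]
  · intro i _ hi
    rw [delPow_eq_zero (by omega), smul_zero]
  · intro h
    exact absurd (Finset.mem_range.2 (Nat.pos_of_ne_zero hn)) h

theorem ad_pow_mem_Wp (w : W k p n) (i : ℕ) : LieAlgebra.ad k (W k p n) w ^ p ^ i ∈ Wp k p n := by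
  have h : ∀ S ∈ {S : LieSubalgebra k (Module.End k (W k p n)) |
      (LieAlgebra.ad k (W k p n)).range ≤ S ∧ ∀ E ∈ S, E ^ p ∈ S},
      LieAlgebra.ad k (W k p n) w ^ p ^ i ∈ S := by
    rintro S ⟨h1, h2⟩
    induction i with
    | zero =>
      rw [pow_zero, pow_one]
      exact h1 ⟨w, rfl⟩
    | succ i ih =>
      rw [pow_succ, pow_mul]
      exact h2 _ ih
  rw [Wp, ← SetLike.mem_coe, LieSubalgebra.coe_sInf]
  simpa using h

theorem act_sum_delPow_mem_Wp (Φ : G k p n) (s : Finset ℕ) (c : ℕ → k) :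
    act Φ (∑ i ∈ s, c i • delPow k p n i) ∈ Wp k p n := by
  rw [act_sum_smul]
  refine (Wp k p n).toSubmodule.sum_mem fun i _ => (Wp k p n).smul_mem _ ?_
  rw [delPow, act_pow, act_ad]
  exact ad_pow_mem_Wp _ i

/-- Elements of `W(1;n)_(0)` carry derivations that preserve the maximal ideal to derivations with
values in the maximal ideal. -/
theorem apply_of_mem_adW0 {E : Module.End k (W k p n)} (hE : E ∈ adW0 k p n) (w : W k p n)
    (hw : ∀ f : O k p n, (f : DPSeries k) 0 = 0 → (w.1 f : DPSeries k) 0 = 0) (f : O k p n) :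
    ((E w).1 f : DPSeries k) 0 = 0 := by
  induction hE using Submodule.span_induction with
  | mem E h =>
    obtain ⟨a, h1, h2, rfl⟩ := h
    have ha := lt_of_le_pred h2
    have h0 : ∀ g : O k p n, ((X k p n a * g : O k p n) : DPSeries k) 0 = 0 := fun g => by
      rw [MulMemClass.coe_mul, mul_apply_zero, coe_X ha, x_apply, if_neg (by omega), zero_mul]
    rw [normalizerPairs_apply (ad_mem_normalizerPairs (mulDel k p n (X k p n a)))]
    change (X k p n a * del k p n (w.1 f) - w.1 (X k p n a * del k p n f) : O k p n).1 0 = 0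
    have e1 := h0 (del k p n (w.1 f))
    have e2 := hw _ (h0 (del k p n f))
    exact (congrArg₂ (· - ·) e1 e2).trans (sub_zero 0)
  | zero => rfl
  | add E F _ _ hE hF => exact (congrArg₂ (· + ·) hE hF).trans (add_zero 0)
  | smul r E _ hE => exact (congrArg (r * ·) hE).trans (mul_zero r)

/-- With `q = p^(n-1)`, the derivation `x^(q)∂` has values in the maximal ideal, but its bracket
with `∂^q` takes `x` to an element of constant term `1`. By `apply_of_mem_adW0` this excludes
membership in `W_(0)`, and conjugation by `Φ` keeps the maximal ideal. -/
theorem act_smul_delPow_notMem_adW0 (hn : n ≠ 0) (Φ : G k p n) {r : k} (hr : r ≠ 0) :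
    act Φ (r • delPow k p n (n - 1)) ∉ adW0 k p n := by
  intro h
  have hp : p.Prime := Fact.out
  have hpn : 1 < p ^ n := Nat.one_lt_pow hn hp.one_lt
  have hq : p ^ (n - 1) < p ^ n := Nat.pow_lt_pow_right hp.one_lt (by omega)
  have hq0 : 0 < p ^ (n - 1) := pow_pos hp.pos _
  have hX : del k p n (X k p n 1) = 1 := by
    rw [← X_zero]
    exact del_X (a := 0) hpn
  have hX0 : ∀ g : O k p n, ((X k p n (p ^ (n - 1)) * g : O k p n) : DPSeries k) 0 = 0 :=
    fun g => by
      rw [MulMemClass.coe_mul, mul_apply_zero, coe_X hq, x_apply, if_neg (by omega), zero_mul]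
  have h1 := apply_of_mem_adW0 h (conjW Φ (mulDel k p n (X k p n (p ^ (n - 1)))))
    (fun f _ => by
      rw [conjW_apply_apply, apply_coe_zero_eq_zero_iff]
      exact hX0 _) (Φ.1 (X k p n 1))
  rw [act_apply, conjW_inv_apply_conjW, conjW_apply_apply, AlgEquiv.symm_apply_apply,
    apply_coe_zero_eq_zero_iff, LinearMap.smul_apply, coe_smul_apply,
    normalizerPairs_apply (delPow_mem_normalizerPairs (n - 1)), coe_mulDel_apply,
    coe_mulDel_apply, hX, mul_one] at h1
  have h2 : r * ((delEnd k p n ^ p ^ (n - 1)) (X k p n (p ^ (n - 1))) : DPSeries k) 0 -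
      r * ((X k p n (p ^ (n - 1)) *
        del k p n ((delEnd k p n ^ p ^ (n - 1)) (X k p n 1)) : O k p n) : DPSeries k) 0 = 0 := by
    rw [← mul_sub]
    exact h1
  rw [hX0, delEnd_pow_apply_X _ _ hq, if_pos rfl, mul_one, mul_zero, sub_zero] at h2
  exact hr h2

theorem act_sum_delPow_mem_nilpotentReg (hn : n ≠ 0) (Φ : G k p n) {c : ℕ → k} (hc : c 0 ≠ 0) :
    act Φ (∑ i ∈ Finset.range n, c i • delPow k p n i) ∈ nilpotentReg k p n := by
  refine ⟨⟨act_sum_delPow_mem_Wp Φ _ c, n, fun N hN => ?_⟩, ?_⟩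
  · rw [← act_pow, sum_smul_delPow_pow_eq_zero c _ hN]
    exact LinearEquiv.map_zero _
  · rw [← act_pow, sum_smul_delPow_pow_pred hn]
    exact act_smul_delPow_notMem_adW0 hn Φ (pow_ne_zero _ hc)

/-! ### Regular nilpotent elements are conjugate to combinations of the `∂^(p^i)`. -/

theorem pow_eq_zero_of_isNilpotent {D : Module.End k (O k p n)} {m : ℕ} (h : D ^ m = 0) :
    D ^ p ^ n = 0 := by
  have h1 := Module.End.ker_pow_le_ker_pow_finrank D m
  rw [finrank_O, h, LinearMap.ker_zero, top_le_iff] at h1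
  exact LinearMap.ker_eq_top.1 h1

section

variable {D : Module.End k (O k p n)} {E : Module.End k (W k p n)}

/-- If `D` is regular nilpotent then no nontrivial combination of its `p^i`-th powers
lies in `W(1;n)_(0)`. -/
theorem eq_zero_of_sum_pow_apply_X (hn : n ≠ 0) (h : (D, E) ∈ normalizerPairs k p n)
    (hD : D ^ p ^ n = 0) (hE : E ^ p ^ (n - 1) ∉ adW0 k p n) {c : ℕ → k}
    (hc : ∀ i < n, ((∑ j ∈ Finset.range n, c j • D ^ p ^ j) (X k p n (p ^ i)) : DPSeries k) 0 = 0)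
    {j : ℕ} (hj : j < n) : c j = 0 := by
  have hp : p.Prime := Fact.out
  by_contra hcj
  classical
  have hex : ∃ j, j < n ∧ c j ≠ 0 := ⟨j, hj, hcj⟩
  obtain ⟨hm, hcm⟩ := Nat.find_spec hex
  have hmin := fun {i : ℕ} (hi : i < Nat.find hex) => Nat.find_min hex hi
  set m := Nat.find hex
  have hs := sum_mem_normalizerPairs (fun i => pow_mem_normalizerPairs h i) (Finset.range n) c
  obtain ⟨f, hf, hF, -⟩ := exists_eq_ad_mulDel hn hs hc
  -- With `m` the least index such that `c m ≠ 0`, raising to the power `p^(n-1-m)` moves the `m`-th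
  -- term to `D^(p^(n-1))` and all later ones to exponents at least `p^n`, where they vanish.
  have hpow : (∑ j ∈ Finset.range n, c j • D ^ p ^ j) ^ p ^ (n - 1 - m) =
      c m ^ p ^ (n - 1 - m) • D ^ p ^ (n - 1) := by
    rw [sum_smul_pow_char_pow_pow, Finset.sum_eq_single m]
    · rw [show m + (n - 1 - m) = n - 1 by omega]
    · intro i hi him
      rcases Nat.lt_or_gt_of_ne him with hlt | hgt
      · have : c i = 0 := by
          by_contra hci
          exact hmin hlt ⟨Finset.mem_range.1 hi, hci⟩
        rw [this, zero_pow (pow_pos hp.pos _).ne', zero_smul]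
      · rw [show i + (n - 1 - m) = n + (i - m - 1) by omega, pow_add, pow_mul, hD,
          zero_pow (pow_pos hp.pos _).ne', smul_zero]
    · intro hm'
      exact absurd (Finset.mem_range.2 hm) hm'
  -- The combination is `f∂` with `f(0) = 0`, so it and its positive powers have values in the
  -- maximal ideal.
  have hzero : ∀ g, ((D ^ p ^ (n - 1)) g : DPSeries k) 0 = 0 := fun g => by
    have h1 := LinearMap.congr_fun hpow g
    obtain ⟨q, hq⟩ := Nat.exists_eq_succ_of_ne_zero (pow_pos hp.pos (n - 1 - m)).ne'
    rw [hq, pow_succ', Module.End.mul_apply, ← hq] at h1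
    nth_rw 1 [hF] at h1
    have h2 := DFunLike.congr_fun (congrArg Subtype.val h1) 0
    have h3 : c m ^ p ^ (n - 1 - m) * ((D ^ p ^ (n - 1)) g : DPSeries k) 0 = 0 := by
      refine h2.symm.trans ?_
      refine (mul_apply_zero (f : DPSeries k) _).trans ?_
      rw [hf, zero_mul]
    exact (mul_eq_zero.1 h3).resolve_left (pow_ne_zero _ hcm)
  obtain ⟨f', hf', -, hE'⟩ := exists_eq_ad_mulDel hn (pow_mem_normalizerPairs h (n - 1))
    fun i _ => hzero _
  exact hE (hE' ▸ ad_mulDel_mem_adW0 hf')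

theorem exists_sum_pow_apply_X (hn : n ≠ 0) (h : (D, E) ∈ normalizerPairs k p n)
    (hD : D ^ p ^ n = 0) (hE : E ^ p ^ (n - 1) ∉ adW0 k p n) :
    ∃ c : ℕ → k, ∀ i < n, ((∑ j ∈ Finset.range n, c j • D ^ p ^ j) (X k p n (p ^ i)) :
      DPSeries k) 0 = if i = 0 then 1 else 0 := by
  let v : Fin n → Fin n → k := fun j i => ((D ^ p ^ (j : ℕ)) (X k p n (p ^ (i : ℕ))) : DPSeries k) 0
  have hv : ∀ (c : ℕ → k) (i : Fin n), ((∑ j ∈ Finset.range n, c j • D ^ p ^ j)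
      (X k p n (p ^ (i : ℕ))) : DPSeries k) 0 = (∑ j : Fin n, c j • v j) i := fun c i => by
    simp only [LinearMap.sum_apply, LinearMap.smul_apply]
    rw [coe_sum_smul_apply, Finset.sum_range, Finset.sum_apply]
    rfl
  let ext0 : (Fin n → k) → ℕ → k := fun g j => if hj : j < n then g ⟨j, hj⟩ else 0
  have hext : ∀ (g : Fin n → k) (j : Fin n), ext0 g j = g j := fun g j => dif_pos j.2
  have hli : LinearIndependent k v := by
    rw [Fintype.linearIndependent_iff]
    intro g hg j
    rw [← hext g j]
    refine eq_zero_of_sum_pow_apply_X hn h hD hE (fun i hi => ?_) j.2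
    rw [hv _ ⟨i, hi⟩]
    simp only [hext]
    rw [hg]
    rfl
  -- Being `n` independent vectors in `k^n`, the `v j` also span the vector of `∂`.
  have hspan := hli.span_eq_top_of_card_eq_finrank' (by simp)
  have hmem : (fun i : Fin n => if (i : ℕ) = 0 then (1 : k) else 0) ∈
      Submodule.span k (Set.range v) := hspan ▸ Submodule.mem_top
  obtain ⟨g, hg⟩ := (Submodule.mem_span_range_iff_exists_fun k).1 hmem
  refine ⟨ext0 g, fun i hi => ?_⟩
  rw [hv _ ⟨i, hi⟩]
  simp only [hext]
  rw [hg]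

end

/-- A regular nilpotent element commutes with a conjugate of `∂`. -/
theorem exists_apply_conjW_eq_zero (hn : n ≠ 0) {D : Module.End k (O k p n)}
    {E : Module.End k (W k p n)} (h : (D, E) ∈ normalizerPairs k p n)
    (hD : D ^ p ^ n = 0) (hE : E ^ p ^ (n - 1) ∉ adW0 k p n) :
    ∃ Φ : G k p n, E (conjW Φ (mulDel k p n 1)) = 0 := by
  have hp : p.Prime := Fact.out
  obtain ⟨c, hc⟩ := exists_sum_pow_apply_X hn h hD hE
  obtain ⟨F, hF⟩ : ∃ F, F = ∑ j ∈ Finset.range n, c j • D ^ p ^ j := ⟨_, rfl⟩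
  have hs := sum_mem_normalizerPairs (fun i => pow_mem_normalizerPairs h i) (Finset.range n) c
  rw [← hF] at hs hc
  have hd := (normalizerPairs k p n).sub_mem hs (delPow_mem_normalizerPairs 0)
  -- `F` and `∂` have the same constant terms at the `x^(p^i)`, so `F - ∂ = f∂` with `f(0) = 0`.
  obtain ⟨f, hf, hFf, -⟩ := exists_eq_ad_mulDel hn hd fun i hi => by
    have hi' : p ^ i < p ^ n := Nat.pow_lt_pow_right hp.one_lt hi
    have e1 := hc i hi
    have e2 := delEnd_pow_apply_X (k := k) (p ^ 0) (p ^ i) hi'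
    refine (congrArg₂ (· - ·) e1 e2).trans ?_
    simp only [(Nat.pow_right_injective hp.two_le).eq_iff, eq_comm (a := 0)]
    exact sub_self _
  have hFg : ((mulDel k p n (1 + f)).1 : O k p n →ₗ[k] O k p n) = F := by
    refine LinearMap.ext fun g => ?_
    have h1 := LinearMap.congr_fun hFf g
    rw [pow_zero, pow_one] at h1
    change (1 + f) * del k p n g = F g
    have h2 : F g - del k p n g = f * del k p n g := h1
    linear_combination -h2
  have hnil : F ^ p ^ n = 0 := by
    rw [hF, sum_smul_pow_char_pow_pow]
    refine Finset.sum_eq_zero fun i _ => ?_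
    rw [add_comm i n, pow_add, pow_mul, hD, zero_pow (pow_pos hp.pos _).ne', smul_zero]
  have hDF : D * F = F * D := by
    rw [hF, Finset.mul_sum, Finset.sum_mul]
    refine Finset.sum_congr rfl fun i _ => ?_
    rw [mul_smul_comm, smul_mul_assoc, ← pow_succ, ← pow_succ']
  have hf1 : ((1 + f : O k p n) : DPSeries k) 0 ≠ 0 := by
    have e : ((1 + f : O k p n) : DPSeries k) 0 = 1 := by
      refine (congrArg ((1 : DPSeries k) 0 + ·) hf).trans ?_
      rw [add_zero, one_apply, if_pos rfl]
    exact e.trans_ne one_ne_zero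
  obtain ⟨Φ, hΦ⟩ := exists_conjW_eq_mulDel hf1 (hFg.symm ▸ hnil)
  refine ⟨Φ, hΦ ▸ Subtype.ext (Derivation.ext fun g => ?_)⟩
  rw [normalizerPairs_apply h]
  have e : ∀ g, (mulDel k p n (1 + f)).1 g = F g := fun g => LinearMap.congr_fun hFg g
  rw [e, e]
  exact sub_eq_zero.2 (LinearMap.congr_fun hDF g)

/-- Regular nilpotent elements are conjugate to combinations of the `∂^(p^i)`. -/
theorem exists_eq_act_of_mem_nilpotentReg (hn : n ≠ 0) {E : Module.End k (W k p n)}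
    (hE : E ∈ nilpotentReg k p n) :
    ∃ (Φ : G k p n) (c : ℕ → k), c 0 ≠ 0 ∧
      E = act Φ (∑ i ∈ Finset.range n, c i • delPow k p n i) := by
  obtain ⟨⟨hWp, N, hN⟩, hreg⟩ := hE
  obtain ⟨D, h⟩ := exists_normalizerPairs_of_mem_Wp hWp
  have hD : D ^ p ^ n = 0 := by
    have h1 := pow_mem_normalizerPairs h N
    rw [hN N le_rfl] at h1
    exact pow_eq_zero_of_isNilpotent (eq_zero_of_normalizerPairs hn h1)
  obtain ⟨Φ, hΦ⟩ := exists_apply_conjW_eq_zero hn h hD hreg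
  have hcomm : act Φ⁻¹ E (mulDel k p n 1) = 0 := by
    have e := act_apply Φ⁻¹ E (mulDel k p n 1)
    rw [inv_inv, hΦ] at e
    exact e.trans (conjW Φ⁻¹).toLinearEquiv.map_zero
  obtain ⟨d, hd⟩ := eq_sum_delPow (act_mem_normalizerPairs Φ⁻¹ h) hcomm
  have hEd : E = act Φ (∑ i ∈ Finset.range n, d i • delPow k p n i) :=
    (act_act_inv Φ E).symm.trans (congrArg (act Φ) hd)
  -- If `d 0 = 0`, then `E^(p^(n-1)) = 0`, which lies in `W_(0)`.
  refine ⟨Φ, d, fun hd0 => hreg ?_, hEd⟩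
  rw [hEd, ← act_pow, sum_smul_delPow_pow_pred hn, hd0,
    zero_pow (pow_pos (Fact.out : p.Prime).pos _).ne', zero_smul]
  have e : act Φ 0 = 0 := LinearEquiv.map_zero _
  rw [e]
  exact Submodule.zero_mem _

/-! ### Normal forms. -/

/-- The automorphisms `x ↦ r x`. -/
theorem exists_act_delPow_eq {r : k} (hr : r ≠ 0) :
    ∃ Φ : G k p n, ∀ i, act Φ (delPow k p n i) = r⁻¹ ^ p ^ i • delPow k p n i := by
  have hy : ∀ a, dpowAux (r • (x 1 : DPSeries k)) a = r ^ a • x a := fun a => by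
    rw [Algebra.smul_def, dpowAux_mul x_one_mem, ← dpow_eq x_one_mem, dpow_x, Algebra.smul_def,
      map_pow]
  have hdy : DPSeries.deriv (r • (x 1 : DPSeries k)) = algebraMap k _ r := by
    rw [map_smul, deriv_x_succ, Algebra.algebraMap_eq_smul_one]
    rfl
  refine ⟨substG (r • x 1) (fun a ha => hy a ▸ (O k p n).smul_mem (x_mem ha) _)
    (hdy ▸ (isUnit_iff_ne_zero.2 hr).map (algebraMap k (DPSeries k))), fun i => ?_⟩
  have h : ((r⁻¹ • 1 : O k p n) : DPSeries k) * DPSeries.deriv (r • (x 1 : DPSeries k)) = 1 := by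
    rw [hdy]
    change (r⁻¹ • 1 : DPSeries k) * _ = 1
    rw [← Algebra.algebraMap_eq_smul_one, ← map_mul, inv_mul_cancel₀ hr, map_one]
  rw [delPow, act_pow, act_ad, conj_substG _ _ h, mulDel_smul, map_smul, smul_pow]

theorem sum_smul_delPow_eq {t : ℕ} (ht : t < n) {c : ℕ → k} (hc : ∀ i, t < i → i < n → c i = 0) :
    ∑ i ∈ Finset.range n, c i • delPow k p n i =
      c t • delPow k p n t + ∑ i ∈ Finset.range t, c i • delPow k p n i := by
  rw [add_comm, ← Finset.sum_range_succ]
  refine (Finset.sum_subset (Finset.range_subset_range.2 ht) fun i hi hi' => ?_).symm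
  rw [hc i (by simpa using hi') (by simpa using hi), zero_smul]

theorem exists_act_eq_of_mem_nilpotentReg [IsAlgClosed k] (hn : n ≠ 0) {E : Module.End k (W k p n)}
    (hE : E ∈ nilpotentReg k p n) :
    ∃ (Φ : G k p n) (t : ℕ) (c : ℕ → k), t < n ∧ (t = 0 ∨ c 0 ≠ 0) ∧
      act Φ E = delPow k p n t + ∑ i ∈ Finset.range t, c i • delPow k p n i := by
  obtain ⟨Φ, c, hc0, rfl⟩ := exists_eq_act_of_mem_nilpotentReg hn hE
  classical
  set t := Nat.findGreatest (fun i => c i ≠ 0) (n - 1) with ht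
  have htn : t < n := by
    have : t ≤ n - 1 := Nat.findGreatest_le _
    omega
  have hct : c t ≠ 0 := Nat.findGreatest_spec (P := fun i => c i ≠ 0) (Nat.zero_le _) hc0
  have hmax : ∀ i, t < i → i < n → c i = 0 := fun i h1 h2 =>
    not_not.1 (Nat.findGreatest_is_greatest h1 (by omega))
  -- Rescaling by `r` multiplies the coefficient of `∂^(p^t)` by `r^(-p^t)`, so this `r` turns `c t`
  -- into `1`.
  obtain ⟨r, hr⟩ := IsAlgClosed.exists_pow_nat_eq (c t) (pow_pos (Fact.out : p.Prime).pos t)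
  have hr0 : r ≠ 0 := by
    rintro rfl
    rw [zero_pow (pow_pos (Fact.out : p.Prime).pos t).ne'] at hr
    exact hct hr.symm
  obtain ⟨Ψ, hΨ⟩ := exists_act_delPow_eq (p := p) (n := n) hr0
  refine ⟨Ψ * Φ⁻¹, t, fun i => c i * r⁻¹ ^ p ^ i, htn,
    Or.inr (mul_ne_zero hc0 (pow_ne_zero _ (inv_ne_zero hr0))), ?_⟩
  rw [act_mul, act_inv_act, act_sum_smul]
  simp only [hΨ, smul_smul]
  rw [sum_smul_delPow_eq htn (c := fun i => c i * r⁻¹ ^ p ^ i)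
    fun i h1 h2 => by rw [hmax i h1 h2, zero_mul]]
  rw [← hr, inv_pow, mul_inv_cancel₀ (pow_ne_zero _ hr0), one_smul]

theorem mem_nilpotentReg_of_act_eq (hn : n ≠ 0) {E : Module.End k (W k p n)} {Φ : G k p n} {t : ℕ}
    {c : ℕ → k} (ht : t < n) (hc : t = 0 ∨ c 0 ≠ 0)
    (h : act Φ E = delPow k p n t + ∑ i ∈ Finset.range t, c i • delPow k p n i) :
    E ∈ nilpotentReg k p n := by
  let d : ℕ → k := fun i => if i < t then c i else if i = t then 1 else 0
  have hd : act Φ E = ∑ i ∈ Finset.range n, d i • delPow k p n i := by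
    rw [h, sum_smul_delPow_eq ht fun i h1 _ => by
      simp only [d]
      rw [if_neg (by omega), if_neg (by omega)]]
    congr 1
    · simp [d]
    · exact Finset.sum_congr rfl fun i hi => by simp only [d]; rw [if_pos (Finset.mem_range.1 hi)]
  have hd0 : d 0 ≠ 0 := by
    rcases Nat.eq_zero_or_pos t with rfl | hpos
    · simp [d]
    · simp only [d]
      rw [if_pos hpos]
      exact hc.resolve_left hpos.ne'
  rw [← act_inv_act Φ E, hd]
  exact act_sum_delPow_mem_nilpotentReg hn Φ⁻¹ hd0

end Zassenhaus

theorem lemmal {k : Type*} [Field k] [IsAlgClosed k] {p : ℕ} [Fact p.Prime] [CharP k p]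
    (hp : 3 < p) {n : ℕ} (hn : 2 ≤ n) :
    Zassenhaus.nilpotentReg k p n =
        {E | ∃ (Φ : Zassenhaus.G k p n) (c : ℕ → k), c 0 ≠ 0 ∧
          E = Zassenhaus.act Φ (∑ i ∈ Finset.range n, c i • Zassenhaus.delPow k p n i)} ∧
      ∀ E : Module.End k (Zassenhaus.W k p n),
        E ∈ Zassenhaus.nilpotentReg k p n ↔
          ∃ (Φ : Zassenhaus.G k p n) (t : ℕ) (c : ℕ → k), t < n ∧ (t = 0 ∨ c 0 ≠ 0) ∧
            Zassenhaus.act Φ E = Zassenhaus.delPow k p n t +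
              ∑ i ∈ Finset.range t, c i • Zassenhaus.delPow k p n i := by
  have hn0 : n ≠ 0 := by omega
  refine ⟨Set.ext fun E => ⟨Zassenhaus.exists_eq_act_of_mem_nilpotentReg hn0, ?_⟩,
    fun E => ⟨Zassenhaus.exists_act_eq_of_mem_nilpotentReg hn0, ?_⟩⟩
  · rintro ⟨Φ, c, hc, rfl⟩
    exact Zassenhaus.act_sum_delPow_mem_nilpotentReg hn0 Φ hc
  · rintro ⟨Φ, t, c, ht, hc, h⟩
    exact Zassenhaus.mem_nilpotentReg_of_act_eq hn0 ht hc h
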